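/- Let $n\ge 3$, let $\mathbb S^n\subset\mathbb R^{n+1}$ be the unit sphere with its standard metric and geodesic distance $d$, let $\mathbf n=(0,\dots,0,1)$ and $\mathbf s=(0,\dots,0,-1)$ be its north and south poles, and let $\mathcal L_{\mathbb S^n}=\Delta_{\mathbb S^n}-\frac{n(n-2)}{4}$ be the conformal Laplacian, where $\Delta_{\mathbb S^n}$ is the Laplace–Beltrami operator. Let $\frac{\partial}{\partial\theta_{n+1}}$ denote the vector field on $\mathbb S^n\setminus\{\mathbf n,\mathbf s\}$ that is tangent to the meridians (the geodesics through $\mathbf n$ and $\mathbf s$) and along which the coordinate function $\theta_{n+1}$ has derivative $1$, and let $\nabla_X$ denote differentiation in the direction of $X$. Let $K$ be a $C^1$ function on $\mathbb S^n$ such that $\nabla_{\frac{\partial}{\partial\theta_{n+1}}}K\ge 0$ on $\mathbb S^n\setminus\{\mathbf n,\mathbf s\}$ and $\nabla_{\frac{\partial}{\partial\theta_{n+1}}}K$ is not identically zero there. Consider $$-\mathcal L_{\mathbb S^n}v=K(\theta)\,v^{\frac{n+2}{n-2}}\quad\text{and}\quad v>0\qquad\text{on }\mathbb S^n\setminus\{\mathbf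 n\}.\tag{$*$}$$ If $v\in C^2(\mathbb S^n\setminus\{\mathbf n\})$ is a solution of $(*)$ satisfying $\liminf_{\theta\to\mathbf n}v(\theta)>0$ (the value $+\infty$ is allowed), then there is a constant $C_0>0$ such that $$v(\theta)\ge C_0\,d(\theta,\mathbf n)^{-\frac{n-2}{2}}\quad\text{for all }\theta\in\mathbb S^n\setminus\{\mathbf n\}.$$ In particular, $(*)$ has no solution $v\in C^2(\mathbb S^n)$. -/

import Mathlib

open Set Filter Topology
open scoped Manifold ContDiff

noncomputable section

/-- The unit sphere `𝕊ⁿ` in `ℝⁿ⁺¹`, with the smooth structure that Mathlib gives it. -/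
abbrev Sph (n : ℕ) : Type := Metric.sphere (0 : EuclideanSpace ℝ (Fin (n + 1))) 1

namespace Sph

variable {n : ℕ}

/-- The last coordinate `θ_{n+1}` of a point of `𝕊ⁿ`. -/
def height (θ : Sph n) : ℝ := (θ : EuclideanSpace ℝ (Fin (n + 1))) (Fin.last n)

/-- The last vector `(0, …, 0, 1)` of the standard basis of `ℝⁿ⁺¹`. -/
def lastVec (n : ℕ) : EuclideanSpace ℝ (Fin (n + 1)) := EuclideanSpace.single (Fin.last n) 1

/-- The north pole `(0, …, 0, 1)`. -/
def north (n : ℕ) : Sph n := ⟨lastVec n, by simp [lastVec]⟩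

/-- The south pole `(0, …, 0, -1)`. -/
def south (n : ℕ) : Sph n := -north n

/-- The geodesic distance on `𝕊ⁿ` for the standard metric: the angle between the two unit vectors
(Mathlib's `dist` on the sphere is the length of the chord). -/
def geoDist (θ σ : Sph n) : ℝ :=
  InnerProductGeometry.angle (θ : EuclideanSpace ℝ (Fin (n + 1))) (σ : EuclideanSpace ℝ (Fin (n + 1)))

theorem normalize_mem {x : EuclideanSpace ℝ (Fin (n + 1))} (hx : x ≠ 0) :
    ‖x‖⁻¹ • x ∈ Metric.sphere (0 : EuclideanSpace ℝ (Fin (n + 1))) 1 := by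
  simp [norm_smul, hx]

open Classical in
/-- The extension of a function on `𝕊ⁿ` to `ℝⁿ⁺¹ \ {0}` that is constant along rays,
`x ↦ f (x / |x|)` (with the value `0` at the origin, which plays no role). -/
def radialExt (f : Sph n → ℝ) (x : EuclideanSpace ℝ (Fin (n + 1))) : ℝ :=
  if hx : x ≠ 0 then f ⟨‖x‖⁻¹ • x, normalize_mem hx⟩ else 0

theorem radialExt_coe (f : Sph n → ℝ) (θ : Sph n) :
    radialExt f (θ : EuclideanSpace ℝ (Fin (n + 1))) = f θ := by
  have h1 : ‖(θ : EuclideanSpace ℝ (Fin (n + 1)))‖ = 1 := norm_eq_of_mem_sphere θ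
  have h0 : (θ : EuclideanSpace ℝ (Fin (n + 1))) ≠ 0 := ne_zero_of_mem_unit_sphere θ
  unfold radialExt
  rw [dif_pos h0]
  congr 1
  ext1
  simp

/-- The Laplace–Beltrami operator `Δ_{𝕊ⁿ}` of the standard metric: the restriction to the sphere of
the Euclidean Laplacian of the extension that is constant along rays. It is a local operator, so it
also applies to functions that are of class `C²` on an open subset of the sphere. -/
def laplaceBeltrami (f : Sph n → ℝ) (θ : Sph n) : ℝ :=
  Laplacian.laplacian (radialExt f) (θ : EuclideanSpace ℝ (Fin (n + 1)))

/-- The conformal Laplacian `𝓛_{𝕊ⁿ} = Δ_{𝕊ⁿ} - n (n - 2) / 4`. -/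
def conformalLaplacian (f : Sph n → ℝ) (θ : Sph n) : ℝ :=
  laplaceBeltrami f θ - (n : ℝ) * ((n : ℝ) - 2) / 4 * f θ

/-- The derivative `∇_X f` of a function `f` on `𝕊ⁿ` at `θ` in the direction of a vector `X` that is
tangent to `𝕊ⁿ` at `θ`. -/
def dirDeriv (f : Sph n → ℝ) (θ : Sph n) (X : EuclideanSpace ℝ (Fin (n + 1))) : ℝ :=
  fderiv ℝ (radialExt f) (θ : EuclideanSpace ℝ (Fin (n + 1))) X

/-- The vector field `∂/∂θ_{n+1}` on `𝕊ⁿ \ {north, south}`: the tangent field that is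
tangent to the meridians and along which the coordinate `θ_{n+1}` has derivative `1`. It is
the multiple `(1 - θ_{n+1}²)⁻¹` of the tangential part of the vector `(0, …, 0, 1)`. -/
def dHeight (θ : Sph n) : EuclideanSpace ℝ (Fin (n + 1)) :=
  (1 - height θ ^ 2)⁻¹ • (lastVec n - height θ • (θ : EuclideanSpace ℝ (Fin (n + 1))))

/-- The equation `-𝓛_{𝕊ⁿ} v = K v^{(n+2)/(n-2)}` together with `v > 0`, on `𝕊ⁿ \ {north}`. -/
def IsPosSolution (K v : Sph n → ℝ) : Prop :=
  ∀ θ : Sph n, θ ≠ north n →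
    0 < v θ ∧
      -conformalLaplacian v θ = K θ * v θ ^ (((n : ℝ) + 2) / ((n : ℝ) - 2))

end Sph

end

/-! ### Second derivatives along curves and the Euclidean Laplacian -/

section SecondDerivatives

variable {E : Type*} [NormedAddCommGroup E] [InnerProductSpace ℝ E]

/-! The proof is the method of moving spheres, written with homogeneous functions on `ℝⁿ⁺¹`. Extend
`v` to `V = confExt v`, homogeneous of degree `-(n-2)/2`; this is the degree for which the Euclidean
Laplacian of `V` restricts to the conformal Laplacian of `v`. For such functions, pulling back by `x
↦ (2x, a|x|² - 1/a)` preserves the Laplacian up to the factor 4 (`laplacian_comp_quadric`), whatever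
`a ≠ 0` is. So `z(x) = V(2x, 1 - |x|²)` and `U_a(x) = V(2x, a|x|² - 1/a)`, `a > 0`, solve equations
`-Δu = k u^p` on `ℝⁿ`, `z` with a puncture at `0`, which corresponds to the north pole. `U_a` is the
Kelvin transform of `z` in the sphere `|x|² = 1/a`, where the two agree. Inside that sphere the
point defining `z` lies vertically above the one defining `U_a`. As `K`, extended constantly along
rays, increases along vertical lines, the coefficient of `z` is the larger one.

The claim is `U_a ≤ z` inside the sphere for all `a ≥ 1`. It holds for a small `a₀`
(`confExt_quadric_le_start`): on a bounded set `U_a` is uniformly small while `z` is bounded below,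
and far out `V` increases vertically near the south axis. The set of good `a` is closed; it is open
by `eventually_le`, which combines the strong minimum principle, a lower bound at the puncture and a
minimum principle in thin shells (the last replaces the Hopf lemma). Strictness requires `z ≠ U_a`,
and this is where `K` must really vary (`exists_confExt_quadric_ne`).

Taking `a = 1/|x|` puts the lower point on the hyperplane of the equator, so `V(y, 0) ≤ V(y, h)` for
`(y, h)` in the northern hemisphere. By homogeneity the left side is at least a constant times
`|y|^{-(n-2)/2}`, and `|y|` is the sine of the distance to the pole. A solution that is `C²` on the
whole sphere is bounded, which contradicts this blow-up; there the lower bound of `z` at the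
puncture follows from the equation itself (`confExt_lower_bound`). -/

theorem deriv_deriv_eq_of_hasDerivAt {g g' : ℝ → ℝ} {c x : ℝ}
    (h : ∀ᶠ t in 𝓝 x, HasDerivAt g (g' t) t) (h' : HasDerivAt g' c x) :
    deriv (deriv g) x = c := by
  have : deriv g =ᶠ[𝓝 x] g' := h.mono fun t ht => ht.deriv
  rw [this.deriv_eq, h'.deriv]

theorem hasDerivAt_add_smul_add_sq_smul (x p q : E) (t : ℝ) :
    HasDerivAt (fun t : ℝ => x + t • p + t ^ 2 • q) (p + (2 * t) • q) t := by
  have h1 : HasDerivAt (fun t : ℝ => t • p) p t := by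
    simpa using (hasDerivAt_id t).smul_const p
  have h2 : HasDerivAt (fun t : ℝ => t ^ 2 • q) ((2 * t) • q) t := by
    simpa using (hasDerivAt_pow 2 t).smul_const q
  exact (h1.const_add x).add h2

/-- Straight lines in `ℝⁿ` become parabolas under `quadric a`; their acceleration produces the
first-order term. -/
theorem deriv_deriv_comp_quadratic {f : E → ℝ} {x : E} (hf : ContDiffAt ℝ 2 f x) (p q : E) :
    deriv (deriv fun t : ℝ => f (x + t • p + t ^ 2 • q)) 0 =
      fderiv ℝ (fderiv ℝ f) x p p + 2 * fderiv ℝ f x q := by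
  have hγ := hasDerivAt_add_smul_add_sq_smul x p q
  have hγ0 : x + (0 : ℝ) • p + (0 : ℝ) ^ 2 • q = x := by simp
  have hcont : Tendsto (fun t : ℝ => x + t • p + t ^ 2 • q) (𝓝 0) (𝓝 x) := by
    have := (hγ 0).continuousAt.tendsto
    rwa [hγ0] at this
  have hd : ∀ᶠ t in 𝓝 (0 : ℝ), HasDerivAt (fun t : ℝ => f (x + t • p + t ^ 2 • q))
      (fderiv ℝ f (x + t • p + t ^ 2 • q) (p + (2 * t) • q)) t := by
    have := hcont.eventually (hf.eventually (by simp))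
    filter_upwards [this] with t ht
    exact ((ht.differentiableAt (by simp)).hasFDerivAt).comp_hasDerivAt t (hγ t)
  refine deriv_deriv_eq_of_hasDerivAt hd ?_
  have hfd : ContDiffAt ℝ 1 (fderiv ℝ f) x := hf.fderiv_right (by norm_num)
  have h1 : HasDerivAt (fun t : ℝ => fderiv ℝ f (x + t • p + t ^ 2 • q))
      (fderiv ℝ (fderiv ℝ f) x p) 0 := by
    have h0 : HasFDerivAt (fderiv ℝ f) (fderiv ℝ (fderiv ℝ f) x)
        (x + (0 : ℝ) • p + (0 : ℝ) ^ 2 • q) := by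
      rw [hγ0]; exact (hfd.differentiableAt (by simp)).hasFDerivAt
    exact (h0.comp_hasDerivAt (0 : ℝ) (hγ 0)).congr_deriv (by simp)
  have h2 : HasDerivAt (fun t : ℝ => p + (2 * t) • q) ((2 : ℝ) • q) 0 := by
    have := (((hasDerivAt_id (0 : ℝ)).const_mul 2).smul_const q).const_add p
    simpa using this
  have := h1.clm_apply h2
  simpa using this

theorem deriv_deriv_comp_line {f : E → ℝ} {x : E} (hf : ContDiffAt ℝ 2 f x) (p : E) :
    deriv (deriv fun t : ℝ => f (x + t • p)) 0 = fderiv ℝ (fderiv ℝ f) x p p := by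
  simpa using deriv_deriv_comp_quadratic hf p 0

theorem contDiff_radial_norm_sq (y : E) : ContDiff ℝ 2 fun z : E => ‖z - y‖ ^ 2 :=
  (contDiff_id.sub contDiff_const).norm_sq ℝ

variable [FiniteDimensional ℝ E]

theorem laplacian_eq_sum_fderiv {ι : Type*} [Fintype ι] (b : OrthonormalBasis ι ℝ E)
    (f : E → ℝ) (x : E) :
    Laplacian.laplacian f x = ∑ i, fderiv ℝ (fderiv ℝ f) x (b i) (b i) := by
  rw [InnerProductSpace.laplacian_eq_iteratedFDeriv_orthonormalBasis f b]
  simp [iteratedFDeriv_two_apply]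

theorem laplacian_eq_sum_deriv_deriv {ι : Type*} [Fintype ι] (b : OrthonormalBasis ι ℝ E)
    {f : E → ℝ} {x : E} (hf : ContDiffAt ℝ 2 f x) :
    Laplacian.laplacian f x = ∑ i, deriv (deriv fun t : ℝ => f (x + t • b i)) 0 := by
  rw [laplacian_eq_sum_fderiv b]
  exact Finset.sum_congr rfl fun i _ => (deriv_deriv_comp_line hf _).symm

/-- A negative second derivative would make the point a local maximum too, hence `g` locally
constant. -/
theorem deriv_deriv_nonneg_of_isLocalMin {g : ℝ → ℝ} {x : ℝ} (h : IsLocalMin g x)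
    (hg : ContinuousAt g x) : 0 ≤ deriv (deriv g) x := by
  by_contra! hneg
  have hmax := isLocalMax_of_deriv_deriv_neg hneg h.deriv_eq_zero hg
  have hc : g =ᶠ[𝓝 x] fun _ => g x := by
    filter_upwards [h, hmax] with t h1 h2 using le_antisymm h2 h1
  have hc' : deriv g =ᶠ[𝓝 x] fun _ => 0 := by
    filter_upwards [hc.eventuallyEq_nhds] with t ht
    rw [ht.deriv_eq]; simp
  rw [hc'.deriv_eq] at hneg
  simp at hneg

theorem laplacian_nonneg_of_isLocalMin {f : E → ℝ} {x : E} (h : IsLocalMin f x)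
    (hf : ContDiffAt ℝ 2 f x) : 0 ≤ Laplacian.laplacian f x := by
  rw [laplacian_eq_sum_deriv_deriv (stdOrthonormalBasis ℝ E) hf]
  refine Finset.sum_nonneg fun i _ => ?_
  set e := stdOrthonormalBasis ℝ E i
  have hγ : ContinuousAt (fun t : ℝ => x + t • e) 0 := by fun_prop
  have h0 : x + (0 : ℝ) • e = x := by simp
  refine deriv_deriv_nonneg_of_isLocalMin ?_ ?_
  · have : Tendsto (fun t : ℝ => x + t • e) (𝓝 0) (𝓝 x) := by
      have := hγ.tendsto
      rwa [h0] at this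
    simpa [IsLocalMin, IsMinFilter] using this.eventually h
  · exact ContinuousAt.comp (f := fun t : ℝ => x + t • e) (by rw [h0]; exact hf.continuousAt) hγ

/-- All barriers below are profiles of the squared distance, which is smooth even at the centre. -/
theorem laplacian_radial {φ φ' : ℝ → ℝ} {c : ℝ} (x y : E)
    (hφ : ContDiffAt ℝ 2 φ (‖x - y‖ ^ 2))
    (h : ∀ᶠ s in 𝓝 (‖x - y‖ ^ 2), HasDerivAt φ (φ' s) s)
    (h' : HasDerivAt φ' c (‖x - y‖ ^ 2)) :
    Laplacian.laplacian (fun z : E => φ (‖z - y‖ ^ 2)) x =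
      4 * ‖x - y‖ ^ 2 * c + 2 * (Module.finrank ℝ E) * φ' (‖x - y‖ ^ 2) := by
  have hC : ContDiffAt ℝ 2 (fun z : E => φ (‖z - y‖ ^ 2)) x := by
    refine ContDiffAt.comp (f := fun z : E => ‖z - y‖ ^ 2) x hφ ?_
    exact (contDiffAt_id.sub contDiffAt_const).norm_sq ℝ
  set b := stdOrthonormalBasis ℝ E
  rw [laplacian_eq_sum_deriv_deriv b hC]
  have key : ∀ i, deriv (deriv fun t : ℝ => φ (‖x + t • b i - y‖ ^ 2)) 0 =
      4 * c * (inner ℝ (x - y) (b i)) ^ 2 + 2 * φ' (‖x - y‖ ^ 2) := by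
    intro i
    set e := inner ℝ (x - y) (b i) with he
    have hn : ∀ t : ℝ, ‖x + t • b i - y‖ ^ 2 = ‖x - y‖ ^ 2 + 2 * t * e + t ^ 2 := by
      intro t
      have : x + t • b i - y = (x - y) + t • b i := by abel
      rw [this, norm_add_sq_real, norm_smul, inner_smul_right, b.norm_eq_one i, ← he]
      simp; ring
    simp only [hn]
    have hs : ∀ t : ℝ, HasDerivAt (fun t : ℝ => ‖x - y‖ ^ 2 + 2 * t * e + t ^ 2)
        (2 * e + 2 * t) t := by
      intro t
      have := ((((hasDerivAt_id t).const_mul 2).mul_const e).const_add (‖x - y‖ ^ 2)).add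
        (hasDerivAt_pow 2 t)
      exact this.congr_deriv (by simp)
    have hs0 : ‖x - y‖ ^ 2 + 2 * 0 * e + 0 ^ 2 = ‖x - y‖ ^ 2 := by ring
    have hT : Tendsto (fun t : ℝ => ‖x - y‖ ^ 2 + 2 * t * e + t ^ 2) (𝓝 0)
        (𝓝 (‖x - y‖ ^ 2)) := by
      have := (hs 0).continuousAt.tendsto
      rwa [hs0] at this
    have h1 : ∀ᶠ t in 𝓝 (0 : ℝ), HasDerivAt (fun t : ℝ => φ (‖x - y‖ ^ 2 + 2 * t * e + t ^ 2))
        (φ' (‖x - y‖ ^ 2 + 2 * t * e + t ^ 2) * (2 * e + 2 * t)) t := by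
      filter_upwards [hT.eventually h] with t ht
      exact ht.comp t (hs t)
    refine deriv_deriv_eq_of_hasDerivAt h1 ?_
    have h2 : HasDerivAt (fun t : ℝ => φ' (‖x - y‖ ^ 2 + 2 * t * e + t ^ 2))
        (c * (2 * e + 2 * 0)) 0 := by
      refine HasDerivAt.comp (0 : ℝ) ?_ (hs 0)
      rwa [hs0]
    have h3 : HasDerivAt (fun t : ℝ => 2 * e + 2 * t) 2 0 := by
      simpa using ((hasDerivAt_id (0 : ℝ)).const_mul 2).const_add (2 * e)
    have := h2.mul h3
    rw [hs0] at this
    refine this.congr_deriv ?_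
    ring
  rw [Finset.sum_congr rfl fun i _ => key i, Finset.sum_add_distrib, ← Finset.mul_sum]
  have : ∑ i, (inner ℝ (x - y) (b i)) ^ 2 = ‖x - y‖ ^ 2 := by
    have := b.sum_sq_norm_inner_left (x - y)
    simpa using this
  rw [this]
  simp
  ring

end SecondDerivatives

/-! ### Minimum principles by explicit barriers -/

section MinimumPrinciples

variable {E : Type*} [NormedAddCommGroup E] [InnerProductSpace ℝ E] [FiniteDimensional ℝ E]

/-- A negative minimum would be an interior local minimum with negative Laplacian. Boundary
conditions enter through `T ∈ 𝓝 x`: boundary points must have `f ≥ 0`. -/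
theorem nonneg_of_laplacian_neg {T : Set E} (hT : IsCompact T) {f : E → ℝ} (hf : ContinuousOn f T)
    (h : ∀ x ∈ T, f x < 0 → T ∈ 𝓝 x ∧ ContDiffAt ℝ 2 f x ∧ Laplacian.laplacian f x < 0) :
    ∀ x ∈ T, 0 ≤ f x := by
  intro x hx
  obtain ⟨x₁, hx₁, hmin⟩ := hT.exists_isMinOn ⟨x, hx⟩ hf
  by_contra! hneg
  obtain ⟨hn, hc, hl⟩ := h x₁ hx₁ ((hmin hx).trans_lt hneg)
  exact absurd (laplacian_nonneg_of_isLocalMin (hmin.isLocalMin hn) hc) (not_le.2 hl)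

theorem laplacian_sub_smul {f g : E → ℝ} {x : E} (c : ℝ) (hf : ContDiffAt ℝ 2 f x)
    (hg : ContDiffAt ℝ 2 g x) :
    Laplacian.laplacian (fun y => f y - c * g y) x =
      Laplacian.laplacian f x - c * Laplacian.laplacian g x := by
  have h1 : (fun y => f y - c * g y) = f - c • g := by ext; simp
  rw [h1, hf.laplacian_sub (show ContDiffAt ℝ 2 (c • g) x from hg.const_smul c), InnerProductSpace.laplacian_smul c hg]
  simp

theorem laplacian_pow_sub_norm_sq (S : ℝ) (k : ℕ) (x y : E) :
    Laplacian.laplacian (fun z : E => (S - ‖z - y‖ ^ 2) ^ (k + 2)) x =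
      (k + 2) * (S - ‖x - y‖ ^ 2) ^ k *
        (4 * ‖x - y‖ ^ 2 * (k + 1) - 2 * Module.finrank ℝ E * (S - ‖x - y‖ ^ 2)) := by
  have h0 : ∀ s : ℝ, HasDerivAt (fun s : ℝ => S - s) (-1) s := fun s =>
    (hasDerivAt_id s).const_sub S
  have h1 : ∀ s : ℝ, HasDerivAt (fun s : ℝ => (S - s) ^ (k + 2))
      (-(k + 2) * (S - s) ^ (k + 1)) s := fun s =>
    ((h0 s).pow (k + 2)).congr_deriv (by push_cast; simp; ring)
  have h2 : ∀ s : ℝ, HasDerivAt (fun s : ℝ => -(k + 2) * (S - s) ^ (k + 1))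
      (-(k + 2) * (-(k + 1) * (S - s) ^ k)) s := fun s =>
    (((h0 s).pow (k + 1)).const_mul _).congr_deriv (by push_cast; simp; ring)
  rw [laplacian_radial x y (φ := fun s => (S - s) ^ (k + 2)) (by fun_prop)
    (Eventually.of_forall h1) (h2 _)]
  ring

/-- Positivity spreads from a small ball to the concentric large one. On the shell between them `w`
dominates `ε (R² - |x - y|²)^(k+2)`, which vanishes on the outer sphere and satisfies `Δh > C h`
inside it once `k` is large. -/
theorem pos_on_ball_of_pos_on_closedBall {w : E → ℝ} {y : E} {ρ R C : ℝ} (hρ : 0 < ρ) (hC : 0 ≤ C)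
    (hc : ∀ x ∈ Metric.closedBall y R, ContDiffAt ℝ 2 w x)
    (hnn : ∀ x ∈ Metric.closedBall y R, 0 ≤ w x)
    (hΔ : ∀ x ∈ Metric.closedBall y R, Laplacian.laplacian w x ≤ C * w x)
    (hpos : ∀ x ∈ Metric.closedBall y ρ, 0 < w x) :
    ∀ x ∈ Metric.ball y R, 0 < w x := by
  intro x hx
  by_cases hxρ : x ∈ Metric.closedBall y ρ
  · exact hpos x hxρ
  simp only [Metric.mem_closedBall, dist_eq_norm, not_le, Metric.mem_ball] at hx hxρ
  have hρR : ρ < R := hxρ.trans hx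
  have hR : 0 < R := hρ.trans hρR
  simp only [Metric.mem_closedBall, dist_eq_norm] at hc hnn hΔ hpos
  set N : ℝ := (Module.finrank ℝ E : ℝ)
  -- The good term of `Δh` grows like `4ρ²k` on the shell; this `k` lets it absorb both `C σ²` and
  -- `2Nσ` for `0 < σ ≤ R²`.
  obtain ⟨k, hk⟩ := exists_nat_ge ((C * (R ^ 2) ^ 2 + 1 + 2 * N * R ^ 2) / (4 * ρ ^ 2))
  have hk' : C * (R ^ 2) ^ 2 + 1 + 2 * N * R ^ 2 ≤ 4 * ρ ^ 2 * k := by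
    rw [div_le_iff₀ (by positivity)] at hk; linarith
  obtain ⟨c₀, hc₀, hmin⟩ := (isCompact_closedBall y ρ).exists_forall_le' (f := w) (a := 0)
    (fun x hx => (hc x (by
      rw [Metric.mem_closedBall, dist_eq_norm] at hx; linarith)).continuousAt.continuousWithinAt)
    (fun x hx => hpos x (by rwa [Metric.mem_closedBall, dist_eq_norm] at hx))
  simp only [Metric.mem_closedBall, dist_eq_norm] at hmin
  set h : E → ℝ := fun z => (R ^ 2 - ‖z - y‖ ^ 2) ^ (k + 2) with hh
  set ε : ℝ := c₀ / (R ^ 2) ^ (k + 2) with hε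
  have hεpos : 0 < ε := by positivity
  have hhC : ContDiff ℝ 2 h := (contDiff_const.sub (contDiff_radial_norm_sq y)).pow _
  have hcont : Continuous fun z : E => ‖z - y‖ := by fun_prop
  set T : Set E := {z | ρ ≤ ‖z - y‖ ∧ ‖z - y‖ ≤ R} with hTdef
  have hT : IsCompact T := by
    refine (isCompact_closedBall y R).of_isClosed_subset ?_ ?_
    · exact (isClosed_le continuous_const hcont).inter (isClosed_le hcont continuous_const)
    · intro z hz; simpa [dist_eq_norm] using hz.2
  have main : ∀ z ∈ T, 0 ≤ w z - ε * h z := by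
    refine nonneg_of_laplacian_neg hT ?_ ?_
    · intro z hz
      exact ((hc z hz.2).continuousAt.sub
        (continuousAt_const.mul hhC.continuous.continuousAt)).continuousWithinAt
    · intro z hz hneg
      have hz2 : ‖z - y‖ ^ 2 ≤ R ^ 2 := by gcongr; exact hz.2
      have hz1 : ρ ^ 2 ≤ ‖z - y‖ ^ 2 := by gcongr; exact hz.1
      have hhle : h z ≤ (R ^ 2) ^ (k + 2) := by
        simp only [hh]; gcongr; nlinarith [sq_nonneg ‖z - y‖]
      have hne1 : ρ ≠ ‖z - y‖ := by
        intro he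
        have h1 := hmin z he.symm.le
        have h2 : ε * h z ≤ c₀ := by
          calc ε * h z ≤ ε * (R ^ 2) ^ (k + 2) := by gcongr
            _ = c₀ := by rw [hε]; field_simp
        linarith
      have hne2 : ‖z - y‖ ≠ R := by
        intro he
        have : h z = 0 := by simp [hh, he]
        have := hnn z hz.2
        nlinarith
      have hlt : ‖z - y‖ ^ 2 < R ^ 2 := by
        have := lt_of_le_of_ne hz.2 hne2
        gcongr
      refine ⟨?_, (hc z hz.2).sub (contDiffAt_const.mul hhC.contDiffAt), ?_⟩
      · exact inter_mem (continuousAt_const.eventually_lt hcont.continuousAt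
          (lt_of_le_of_ne hz.1 hne1) |>.mono fun _ h => h.le)
          (hcont.continuousAt.eventually_lt continuousAt_const
          (lt_of_le_of_ne hz.2 hne2) |>.mono fun _ h => h.le)
      · rw [laplacian_sub_smul ε (hc z hz.2) hhC.contDiffAt]
        have hΔh : C * h z < Laplacian.laplacian h z := by
          rw [hh, laplacian_pow_sub_norm_sq]
          set σ := R ^ 2 - ‖z - y‖ ^ 2 with hσ
          have hσ0 : 0 < σ := by linarith
          have hσR : σ ≤ R ^ 2 := by nlinarith [sq_nonneg ‖z - y‖]
          have hN : (0 : ℝ) ≤ N := Nat.cast_nonneg _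
          have h1 : C * (R ^ 2) ^ 2 + 1 ≤ 4 * ‖z - y‖ ^ 2 * (k + 1) - 2 * N * σ := by
            have : 4 * ρ ^ 2 * k ≤ 4 * ‖z - y‖ ^ 2 * (k + 1) := by gcongr; linarith
            have : 2 * N * σ ≤ 2 * N * R ^ 2 := by gcongr
            linarith
          have h2 : C * σ ^ 2 ≤ C * (R ^ 2) ^ 2 := by gcongr
          have h3 : C * σ ^ 2 < (k + 2) * (4 * ‖z - y‖ ^ 2 * (k + 1) - 2 * N * σ) := by
            have : 0 ≤ C * (R ^ 2) ^ 2 := by positivity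
            have hk0 : (0 : ℝ) ≤ k := Nat.cast_nonneg _
            nlinarith
          calc C * σ ^ (k + 2) = σ ^ k * (C * σ ^ 2) := by ring
            _ < σ ^ k * ((k + 2) * (4 * ‖z - y‖ ^ 2 * (k + 1) - 2 * N * σ)) := by gcongr
            _ = _ := by ring
        have h4 := hΔ z hz.2
        have h5 : C * w z ≤ C * (ε * h z) := by gcongr; linarith
        have h6 : ε * (C * h z) < ε * Laplacian.laplacian h z := by gcongr
        linarith
  have hfin := main x ⟨hxρ.le, hx.le⟩
  have : 0 < h x := by
    have : ‖x - y‖ ^ 2 < R ^ 2 := by gcongr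
    exact pow_pos (by linarith) _
  nlinarith

/-- The positivity set is open, and relatively closed in `Ω`: a limit point lies in a ball centred
at a nearby point of positivity, and the preceding lemma applies there. -/
theorem strong_minimum_principle {Ω : Set E} (hΩ : IsOpen Ω) (hconn : IsPreconnected Ω) {w : E → ℝ}
    (hc : ∀ x ∈ Ω, ContDiffAt ℝ 2 w x) (hnn : ∀ x ∈ Ω, 0 ≤ w x)
    (hΔ : ∀ x ∈ Ω, ∃ C : ℝ, 0 ≤ C ∧ ∀ᶠ y in 𝓝 x, Laplacian.laplacian w y ≤ C * w y)
    (hpos : ∃ x ∈ Ω, 0 < w x) : ∀ x ∈ Ω, 0 < w x := by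
  have hsub : Ω ⊆ {x | x ∈ Ω ∧ 0 < w x} := by
    refine hconn.subset_of_closure_inter_subset ?_ ?_ ?_
    · rw [isOpen_iff_mem_nhds]
      rintro x ⟨hx, hwx⟩
      exact inter_mem (hΩ.mem_nhds hx) ((hc x hx).continuousAt.eventually (lt_mem_nhds hwx))
    · obtain ⟨x, hx, hw⟩ := hpos
      exact ⟨x, hx, hx, hw⟩
    · rintro x ⟨hxcl, hx⟩
      obtain ⟨C, hC, hev⟩ := hΔ x hx
      obtain ⟨r, hr, hball⟩ := Metric.nhds_basis_closedBall.mem_iff.1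
        (inter_mem hev (hΩ.mem_nhds hx))
      obtain ⟨y, ⟨hyΩ, hwy⟩, hxy⟩ := Metric.mem_closure_iff.1 hxcl (r / 2) (by positivity)
      have hsub : Metric.closedBall y (r / 2) ⊆ Metric.closedBall x r := by
        refine Metric.closedBall_subset_closedBall' ?_
        rw [dist_comm]; linarith
      obtain ⟨ρ, hρ, hρb⟩ := Metric.nhds_basis_closedBall.mem_iff.1
        ((hc y hyΩ).continuousAt.eventually (lt_mem_nhds hwy))
      refine ⟨hx, pos_on_ball_of_pos_on_closedBall (y := y) (R := r / 2) hρ hC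
        (fun z hz => hc z (hball (hsub hz)).2) (fun z hz => hnn z (hball (hsub hz)).2)
        (fun z hz => (hball (hsub hz)).1) (fun z hz => hρb hz) x hxy⟩
  exact fun x hx => (hsub hx).2

/-- Compare `w` with `ε(1 + M|x|²) + η log |x|²`. The logarithm is subharmonic when the dimension is
at least 2 and tends to `-∞` at the puncture, so no boundary condition is needed there; then `η →
0`. The differential inequality is needed only where `w` is small, since a violation forces `w < 2ε
< δ`. -/
theorem exists_pos_lower_bound_near_puncture (hN : 2 ≤ Module.finrank ℝ E) {w : E → ℝ}
    {C ρ₀ δ : ℝ} (hC : 0 ≤ C) (hρ₀ : 0 < ρ₀) (hδ : 0 < δ)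
    (hc : ∀ x, 0 < ‖x‖ → ‖x‖ < ρ₀ → ContDiffAt ℝ 2 w x)
    (hpos : ∀ x, 0 < ‖x‖ → ‖x‖ < ρ₀ → 0 < w x)
    (hΔ : ∀ x, 0 < ‖x‖ → ‖x‖ < ρ₀ → w x < δ → Laplacian.laplacian w x ≤ C * w x) :
    ∃ ε > 0, ∃ ρ > 0, ∀ x, 0 < ‖x‖ → ‖x‖ < ρ → ε ≤ w x := by
  set N : ℝ := (Module.finrank ℝ E : ℝ) with hN_def
  have hN2 : (2 : ℝ) ≤ N := by
    rw [hN_def]; exact_mod_cast hN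
  set M : ℝ := C + 1 with hM
  have hM1 : 1 ≤ M := by linarith
  obtain ⟨ρ, hρ, hρlt, hρM⟩ : ∃ ρ > 0, ρ < ρ₀ ∧ M * ρ ≤ 1 := by
    refine ⟨min (ρ₀ / 2) (1 / M), by positivity, ?_, ?_⟩
    · exact (min_le_left _ _).trans_lt (by linarith)
    · calc M * min (ρ₀ / 2) (1 / M) ≤ M * (1 / M) := by gcongr; exact min_le_right _ _
        _ = 1 := by field_simp
  have hρ1 : ρ ≤ 1 := by nlinarith
  obtain ⟨c₀, hc₀, hmin⟩ := (isCompact_sphere (0 : E) ρ).exists_forall_le' (f := w) (a := 0)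
    (fun x hx => (hc x (by simp_all) (by simp_all)).continuousAt.continuousWithinAt)
    (fun x hx => hpos x (by simp_all) (by simp_all))
  obtain ⟨ε, hε, hεc, hεδ⟩ : ∃ ε > 0, 2 * ε ≤ c₀ ∧ 2 * ε < δ := by
    refine ⟨min (c₀ / 2) (δ / 3), by positivity, ?_, ?_⟩
    · linarith [min_le_left (c₀ / 2) (δ / 3)]
    · linarith [min_le_right (c₀ / 2) (δ / 3)]
  refine ⟨ε, hε, ρ, hρ, fun x hx hxρ => ?_⟩
  set h : E → ℝ := fun z => 1 + M * ‖z - 0‖ ^ 2 with hh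
  set L : E → ℝ := fun z => Real.log (‖z - 0‖ ^ 2) with hL
  have hhC : ContDiff ℝ 2 h := contDiff_const.add (contDiff_const.mul (contDiff_radial_norm_sq 0))
  have hLC : ∀ z : E, 0 < ‖z‖ → ContDiffAt ℝ 2 L z := fun z hz =>
    (contDiff_radial_norm_sq 0).contDiffAt.log (by rw [sub_zero]; positivity)
  have hΔh : ∀ z : E, Laplacian.laplacian h z = 2 * N * M := by
    intro z
    have h1 : ∀ s : ℝ, HasDerivAt (fun s : ℝ => 1 + M * s) M s := fun s => by
      simpa using ((hasDerivAt_id s).const_mul M).const_add 1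
    rw [hh, laplacian_radial z 0 (φ := fun s => 1 + M * s) (φ' := fun _ => M) (by fun_prop)
      (Eventually.of_forall h1) (hasDerivAt_const _ _)]
    ring
  have hΔL : ∀ z : E, 0 < ‖z‖ → 0 ≤ Laplacian.laplacian L z := by
    intro z hz
    have hz2 : 0 < ‖z - 0‖ ^ 2 := by rw [sub_zero]; positivity
    rw [hL, laplacian_radial z 0 (φ := Real.log) (φ' := fun s => s⁻¹)
      (Real.contDiffAt_log.2 hz2.ne')
      ((lt_mem_nhds hz2).mono fun s hs => Real.hasDerivAt_log (ne_of_gt hs))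
      (hasDerivAt_inv hz2.ne')]
    have : 4 * ‖z - 0‖ ^ 2 * -((‖z - 0‖ ^ 2) ^ 2)⁻¹ + 2 * N * (‖z - 0‖ ^ 2)⁻¹ =
      (2 * N - 4) * (‖z - 0‖ ^ 2)⁻¹ := by field_simp; ring
    rw [this]
    have : 0 ≤ 2 * N - 4 := by linarith
    positivity
  have hstep : ∀ η > 0, 0 ≤ w x - ε * h x - η * L x := by
    intro η hη
    -- On the inner sphere of radius `r` the logarithmic term alone outweighs `ε h ≤ 2ε`.
    obtain ⟨r, hr, hrx, hrL⟩ : ∃ r > 0, r < ‖x‖ ∧ η * Real.log (r ^ 2) ≤ -(2 * ε) := by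
      refine ⟨min (‖x‖ / 2) (Real.exp (-(ε / η))), by positivity,
        (min_le_left _ _).trans_lt (by linarith), ?_⟩
      rw [Real.log_pow]
      have : Real.log (min (‖x‖ / 2) (Real.exp (-(ε / η)))) ≤ -(ε / η) := by
        rw [Real.log_le_iff_le_exp (by positivity)]
        exact min_le_right _ _
      calc η * ((2 : ℕ) * Real.log _) ≤ η * ((2 : ℕ) * -(ε / η)) := by gcongr
        _ = _ := by field_simp; simp
    set T : Set E := {z | r ≤ ‖z‖ ∧ ‖z‖ ≤ ρ} with hTdef
    have hT : IsCompact T := by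
      refine (isCompact_closedBall (0 : E) ρ).of_isClosed_subset ?_ ?_
      · exact (isClosed_le continuous_const continuous_norm).inter
          (isClosed_le continuous_norm continuous_const)
      · intro z hz; simpa using hz.2
    have hCf : ∀ z ∈ T, ContDiffAt ℝ 2 (fun z => w z - ε * h z - η * L z) z := fun z hz =>
      ((hc z (hr.trans_le hz.1) (hz.2.trans_lt hρlt)).sub
        (contDiffAt_const.mul hhC.contDiffAt)).sub
        (contDiffAt_const.mul (hLC z (hr.trans_le hz.1)))
    refine nonneg_of_laplacian_neg hT (fun z hz => (hCf z hz).continuousAt.continuousWithinAt)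
      ?_ x ⟨hrx.le, hxρ.le⟩
    intro z hz hneg
    have hz0 : 0 < ‖z‖ := hr.trans_le hz.1
    have hzρ₀ : ‖z‖ < ρ₀ := hz.2.trans_lt hρlt
    have hwz := hpos z hz0 hzρ₀
    have hh2 : h z ≤ 2 := by
      have : ‖z‖ ^ 2 ≤ ρ ^ 2 := by gcongr; exact hz.2
      have : M * ‖z‖ ^ 2 ≤ M * ρ ^ 2 := by gcongr
      have : M * ρ ^ 2 ≤ 1 := by nlinarith
      simp only [hh, sub_zero]; linarith
    have hL0 : L z ≤ 0 := by
      apply Real.log_nonpos (by positivity)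
      rw [sub_zero]; exact pow_le_one₀ (norm_nonneg z) (hz.2.trans hρ1)
    have hηL : η * L z ≤ 0 := mul_nonpos_of_nonneg_of_nonpos hη.le hL0
    have hεh : ε * h z ≤ 2 * ε := by nlinarith
    have hne1 : r ≠ ‖z‖ := by
      rintro rfl
      have : L z = Real.log (‖z‖ ^ 2) := by simp [hL]
      rw [← this] at hrL
      linarith
    have hne2 : ‖z‖ ≠ ρ := by
      intro he
      have := hmin z (by simpa using he)
      linarith
    refine ⟨?_, hCf z hz, ?_⟩
    · exact inter_mem (continuousAt_const.eventually_lt continuous_norm.continuousAt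
        (lt_of_le_of_ne hz.1 hne1) |>.mono fun _ h => h.le)
        (continuous_norm.continuousAt.eventually_lt continuousAt_const
        (lt_of_le_of_ne hz.2 hne2) |>.mono fun _ h => h.le)
    · rw [laplacian_sub_smul (f := fun z => w z - ε * h z) η
        ((hc z hz0 hzρ₀).sub (contDiffAt_const.mul hhC.contDiffAt)) (hLC z hz0),
        laplacian_sub_smul ε (hc z hz0 hzρ₀) hhC.contDiffAt, hΔh]
      have h1 := hΔ z hz0 hzρ₀ (by linarith)
      have h2 : C * w z ≤ C * (2 * ε) := by gcongr; linarith
      have h3 : 0 ≤ η * Laplacian.laplacian L z := mul_nonneg hη.le (hΔL z hz0)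
      have h4 : 2 * 2 * M ≤ 2 * N * M := by gcongr
      have h5 : ε * (2 * 2 * M) ≤ ε * (2 * N * M) := by gcongr
      have h6 : 0 ≤ ε * C := by positivity
      have h7 : ε * (2 * 2 * M) = 4 * (ε * C) + 4 * ε := by rw [hM]; ring
      linarith
  have hx1 : 1 ≤ h x := by
    have : 0 ≤ M * ‖x - 0‖ ^ 2 := by positivity
    simp only [hh]; linarith
  have hlim : 0 ≤ w x - ε * h x := by
    have ht : Tendsto (fun η : ℝ => w x - ε * h x - η * L x) (𝓝[>] 0)
        (𝓝 (w x - ε * h x - 0 * L x)) :=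
      ((continuous_const.sub (continuous_id.mul continuous_const)).tendsto 0).mono_left
        nhdsWithin_le_nhds
    have := ge_of_tendsto ht (eventually_mem_nhdsWithin.mono fun η hη => hstep η hη)
    simpa using this
  nlinarith

/-- In a thin shell there is a positive `g` with `Δg < -C g`, so `w / g` cannot have a negative
interior minimum. The thickness `δ` depends on `q` but not on `S ≥ q`, so it serves all nearby
spheres simultaneously. -/
theorem exists_narrow_nonneg {C q : ℝ} (hC : 0 ≤ C) (hq : 0 < q) :
    ∃ δ > 0, δ < q ∧ ∀ S ≥ q, ∀ w : E → ℝ,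
      ContinuousOn w {x | S - δ ≤ ‖x‖ ^ 2 ∧ ‖x‖ ^ 2 ≤ S} →
      (∀ x, ‖x‖ ^ 2 = S → 0 ≤ w x) → (∀ x, ‖x‖ ^ 2 = S - δ → 0 ≤ w x) →
      (∀ x, S - δ < ‖x‖ ^ 2 → ‖x‖ ^ 2 < S → w x < 0 →
        ContDiffAt ℝ 2 w x ∧ Laplacian.laplacian w x ≤ C * -w x) →
      ∀ x, S - δ ≤ ‖x‖ ^ 2 → ‖x‖ ^ 2 ≤ S → 0 ≤ w x := by
  set N : ℝ := (Module.finrank ℝ E : ℝ)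
  have hN : (0 : ℝ) ≤ N := Nat.cast_nonneg _
  set M : ℝ := C / (4 * q) + 1 with hM
  have hM1 : 1 ≤ M := by
    have : 0 ≤ C / (4 * q) := by positivity
    linarith
  have hMq : 4 * q * M = C + 4 * q := by rw [hM]; field_simp
  -- The first smallness condition keeps `8|x|² - 4N(S - |x|²) ≥ 4q`, which makes `Δg` negative
  -- enough; the second gives `g ≥ 1/2`.
  obtain ⟨δ, hδ, hδq, hδN, hδM⟩ :
      ∃ δ > 0, δ < q ∧ (8 + 4 * N) * δ ≤ 4 * q ∧ M * δ ^ 2 ≤ 1 / 2 := by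
    refine ⟨min (4 * q / (8 + 4 * N)) (1 / (2 * M)), by positivity, ?_, ?_, ?_⟩
    · refine (min_le_left _ _).trans_lt ?_
      rw [div_lt_iff₀ (by positivity)]; nlinarith
    · calc (8 + 4 * N) * min (4 * q / (8 + 4 * N)) (1 / (2 * M))
          ≤ (8 + 4 * N) * (4 * q / (8 + 4 * N)) := by gcongr; exact min_le_left _ _
        _ = 4 * q := by field_simp
    · have h1 : min (4 * q / (8 + 4 * N)) (1 / (2 * M)) ≤ 1 / (2 * M) := min_le_right _ _
      calc M * min (4 * q / (8 + 4 * N)) (1 / (2 * M)) ^ 2 ≤ M * (1 / (2 * M)) ^ 2 := by gcongr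
        _ = 1 / (4 * M) := by field_simp; norm_num
        _ ≤ 1 / 2 := by apply one_div_le_one_div_of_le <;> linarith
  refine ⟨δ, hδ, hδq, fun S hS w hw hb1 hb2 hΔ x hx1 hx2 => ?_⟩
  set T : Set E := {x | S - δ ≤ ‖x‖ ^ 2 ∧ ‖x‖ ^ 2 ≤ S} with hTdef
  have hcont : Continuous fun z : E => ‖z‖ ^ 2 := by fun_prop
  have hT : IsCompact T := by
    refine (isCompact_closedBall (0 : E) (Real.sqrt S)).of_isClosed_subset ?_ ?_
    · exact (isClosed_le continuous_const hcont).inter (isClosed_le hcont continuous_const)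
    · intro z hz
      simpa using Real.le_sqrt_of_sq_le hz.2
  set g : E → ℝ := fun z => 1 - M * (S - ‖z - 0‖ ^ 2) ^ 2 with hg
  have hgC : ContDiff ℝ 2 g :=
    contDiff_const.sub (contDiff_const.mul ((contDiff_const.sub (contDiff_radial_norm_sq 0)).pow 2))
  have hgpos : ∀ z ∈ T, 1 / 2 ≤ g z := by
    intro z hz
    have h1 : (S - ‖z‖ ^ 2) ^ 2 ≤ δ ^ 2 := by
      apply pow_le_pow_left₀ <;> linarith [hz.1, hz.2]
    have : M * (S - ‖z‖ ^ 2) ^ 2 ≤ M * δ ^ 2 := by gcongr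
    simp only [hg, sub_zero]; linarith
  by_contra! hneg
  obtain ⟨x₁, hx₁, hmin⟩ := hT.exists_isMinOn (f := fun z => w z / g z) ⟨x, hx1, hx2⟩
    (hw.div hgC.continuous.continuousOn fun z hz => by linarith [hgpos z hz])
  set m := w x₁ / g x₁ with hm
  have hg1 := hgpos x₁ hx₁
  have hmneg : m < 0 := by
    have h1 : m ≤ w x / g x := hmin ⟨hx1, hx2⟩
    have h2 : w x / g x < 0 := div_neg_of_neg_of_pos hneg (by linarith [hgpos x ⟨hx1, hx2⟩])
    linarith
  have hwx₁ : w x₁ = m * g x₁ := by rw [hm]; field_simp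
  have hwneg : w x₁ < 0 := by rw [hwx₁]; nlinarith
  have hlt1 : S - δ < ‖x₁‖ ^ 2 := lt_of_le_of_ne hx₁.1 fun h => by
    linarith [hb2 x₁ h.symm]
  have hlt2 : ‖x₁‖ ^ 2 < S := lt_of_le_of_ne hx₁.2 fun h => by
    linarith [hb1 x₁ h]
  have hTn : T ∈ 𝓝 x₁ := inter_mem
    (continuousAt_const.eventually_lt hcont.continuousAt hlt1 |>.mono fun _ h => h.le)
    (hcont.continuousAt.eventually_lt continuousAt_const hlt2 |>.mono fun _ h => h.le)
  obtain ⟨hwC, hwΔ⟩ := hΔ x₁ hlt1 hlt2 hwneg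
  -- Minimality of the quotient, cleared of its denominator: `w - m g` is nonnegative on the shell
  -- and vanishes at `x₁`.
  have hloc : IsLocalMin (fun z => w z - m * g z) x₁ := by
    filter_upwards [hTn] with z hz
    have h1 : m ≤ w z / g z := hmin hz
    rw [le_div_iff₀ (by linarith [hgpos z hz])] at h1
    linarith
  have hpos := laplacian_nonneg_of_isLocalMin hloc (hwC.sub (contDiffAt_const.mul hgC.contDiffAt))
  rw [laplacian_sub_smul m hwC hgC.contDiffAt] at hpos
  have hΔg : Laplacian.laplacian g x₁ < -(C * g x₁) := by
    have h0 : ∀ s : ℝ, HasDerivAt (fun s : ℝ => S - s) (-1) s := fun s =>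
      (hasDerivAt_id s).const_sub S
    have h1 : ∀ s : ℝ, HasDerivAt (fun s : ℝ => 1 - M * (S - s) ^ 2) (2 * M * (S - s)) s :=
      fun s => ((((h0 s).pow 2).const_mul M).const_sub 1).congr_deriv (by push_cast; ring)
    have h2 : ∀ s : ℝ, HasDerivAt (fun s : ℝ => 2 * M * (S - s)) (-(2 * M)) s :=
      fun s => ((h0 s).const_mul (2 * M)).congr_deriv (by ring)
    rw [hg, laplacian_radial x₁ 0 (φ := fun s => 1 - M * (S - s) ^ 2) (by fun_prop)
      (Eventually.of_forall h1) (h2 _)]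
    simp only [sub_zero]
    set s := ‖x₁‖ ^ 2
    have h3 : (8 + 4 * N) * (S - s) ≤ (8 + 4 * N) * δ := by gcongr; linarith
    have h4 : M * (4 * q) ≤ M * (8 * s - 4 * N * (S - s)) := by
      gcongr; nlinarith
    have h5 : C * (1 - M * (S - s) ^ 2) ≤ C * 1 := by
      gcongr; nlinarith [mul_nonneg (by linarith : (0:ℝ) ≤ M) (sq_nonneg (S - s))]
    nlinarith
  rw [hwx₁] at hwΔ
  nlinarith

end MinimumPrinciples

/-! ### The moving-sphere argument for an abstract family -/

section MovingSpheres

variable {E : Type*} [NormedAddCommGroup E] [InnerProductSpace ℝ E]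

theorem abs_rpow_sub_rpow_le {p M s t : ℝ} (hp : 1 ≤ p) (hs : 0 ≤ s) (hsM : s ≤ M) (ht : 0 ≤ t)
    (htM : t ≤ M) : |s ^ p - t ^ p| ≤ p * M ^ (p - 1) * |s - t| := by
  have := Convex.norm_image_sub_le_of_norm_hasDerivWithin_le (f := fun x : ℝ => x ^ p)
    (f' := fun x => p * x ^ (p - 1)) (s := Icc 0 M) (C := p * M ^ (p - 1)) (x := t) (y := s)
    (fun x _ => (Real.hasDerivAt_rpow_const (Or.inr hp)).hasDerivWithinAt)
    (fun x hx => by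
      rw [Real.norm_of_nonneg (mul_nonneg (by linarith) (Real.rpow_nonneg hx.1 _))]
      have := Real.rpow_le_rpow hx.1 hx.2 (by linarith : 0 ≤ p - 1)
      gcongr)
    (convex_Icc 0 M) ⟨ht, htM⟩ ⟨hs, hsM⟩
  simpa [Real.norm_eq_abs] using this

/-- Polar coordinates: the set is the image of an interval times the unit sphere, which is connected
in rank above 1. -/
theorem isPreconnected_punctured_ball (h : 1 < Module.rank ℝ E) (S : ℝ) :
    IsPreconnected {x : E | x ≠ 0 ∧ ‖x‖ ^ 2 < S} := by
  have himg : {x : E | x ≠ 0 ∧ ‖x‖ ^ 2 < S} =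
      (fun q : ℝ × E => q.1 • q.2) '' ({r : ℝ | 0 < r ∧ r < Real.sqrt S} ×ˢ Metric.sphere 0 1) := by
    ext x
    constructor
    · rintro ⟨hx, hxS⟩
      have hx' : 0 < ‖x‖ := norm_pos_iff.2 hx
      refine ⟨(‖x‖, ‖x‖⁻¹ • x), ⟨⟨hx', Real.lt_sqrt_of_sq_lt hxS⟩, ?_⟩, ?_⟩
      · simp [norm_smul, hx]
      · simp [smul_smul, hx]
    · rintro ⟨⟨r, y⟩, ⟨⟨hr, hrS⟩, hy⟩, rfl⟩
      have hy1 : ‖y‖ = 1 := by simpa using hy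
      have hy0 : y ≠ 0 := by rintro rfl; simp at hy1
      refine ⟨smul_ne_zero hr.ne' hy0, ?_⟩
      simp only [norm_smul, hy1, mul_one, Real.norm_eq_abs, sq_abs]
      exact (Real.lt_sqrt hr.le).1 hrS
  rw [himg]
  refine IsPreconnected.image ?_ _ (by fun_prop)
  exact (isPreconnected_Ioo (a := (0 : ℝ)) (b := Real.sqrt S)).prod (isPreconnected_sphere h 0 1)

variable [FiniteDimensional ℝ E]

/-- A family `U a` of solutions of `-ΔU = k U ^ p` on the whole space, together with a solution `z`
of such an equation on the punctured space that agrees with `U a` on `‖x‖ ^ 2 = 1 / a`. -/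
structure SphereComparison (z : E → ℝ) (U : ℝ → E → ℝ) (kz : E → ℝ) (k : ℝ → E → ℝ)
    (p B : ℝ) : Prop where
  one_le : 1 ≤ p
  contDiff_z : ∀ x, x ≠ 0 → ContDiffAt ℝ 2 z x
  pos_z : ∀ x, x ≠ 0 → 0 < z x
  laplacian_z : ∀ x, x ≠ 0 → Laplacian.laplacian z x = -(kz x * z x ^ p)
  contDiff_U : ∀ a, 0 < a → ∀ x, ContDiffAt ℝ 2 (U a) x
  pos_U : ∀ a, 0 < a → ∀ x, 0 < U a x
  laplacian_U : ∀ a, 0 < a → ∀ x, Laplacian.laplacian (U a) x = -(k a x * U a x ^ p)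
  continuous_U : ∀ a, 0 < a → ∀ x, ContinuousAt (fun q : ℝ × E => U q.1 q.2) (a, x)
  k_le : ∀ a, 0 < a → ∀ x, x ≠ 0 → ‖x‖ ^ 2 ≤ 1 / a → k a x ≤ kz x
  abs_k_le : ∀ a, 0 < a → ∀ x, |k a x| ≤ B
  boundary : ∀ a, 0 < a → ∀ x, ‖x‖ ^ 2 = 1 / a → z x = U a x
  ne : ∀ a, 0 < a → ∃ x, x ≠ 0 ∧ ‖x‖ ^ 2 < 1 / a ∧ z x ≠ U a x

namespace SphereComparison

variable {z : E → ℝ} {U : ℝ → E → ℝ} {kz : E → ℝ} {k : ℝ → E → ℝ} {p B : ℝ}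

/-- Replacing `kz` by the smaller `k a` costs nothing because `z ^ p ≥ 0`; what remains is `-k (z^p
- U^p)`, bounded by the Lipschitz constant of the power. No sign of `k` is needed. -/
theorem laplacian_sub_le (h : SphereComparison z U kz k p B) {a : ℝ} (ha : 0 < a) {x : E}
    (hx : x ≠ 0) (hxa : ‖x‖ ^ 2 ≤ 1 / a) {M : ℝ} (hzM : z x ≤ M) (hUM : U a x ≤ M) :
    Laplacian.laplacian (fun y => z y - U a y) x ≤ B * (p * M ^ (p - 1)) * |z x - U a x| := by
  have h1 : Laplacian.laplacian (fun y => z y - U a y) x =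
      Laplacian.laplacian z x - Laplacian.laplacian (U a) x :=
    (h.contDiff_z x hx).laplacian_sub (h.contDiff_U a ha x)
  rw [h1, h.laplacian_z x hx, h.laplacian_U a ha x]
  have h2 := h.k_le a ha x hx hxa
  have h3 : 0 ≤ z x ^ p := Real.rpow_nonneg (h.pos_z x hx).le p
  have h4 : k a x * z x ^ p ≤ kz x * z x ^ p := by gcongr
  have h5 := abs_rpow_sub_rpow_le h.one_le (h.pos_z x hx).le hzM (h.pos_U a ha x).le hUM
  have h6 : -(k a x * (z x ^ p - U a x ^ p)) ≤ |k a x| * |z x ^ p - U a x ^ p| := by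
    rw [← abs_mul]; exact neg_le_abs _
  have h7 : |k a x| * |z x ^ p - U a x ^ p| ≤ B * (p * M ^ (p - 1) * |z x - U a x|) :=
    mul_le_mul (h.abs_k_le a ha x) h5 (abs_nonneg _) ((abs_nonneg _).trans (h.abs_k_le a ha x))
  linarith

theorem bound_nonneg (h : SphereComparison z U kz k p B) : 0 ≤ B :=
  (abs_nonneg _).trans (h.abs_k_le 1 one_pos 0)

theorem coeff_nonneg (h : SphereComparison z U kz k p B) {M : ℝ} (hM : 0 ≤ M) :
    0 ≤ B * (p * M ^ (p - 1)) :=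
  mul_nonneg h.bound_nonneg (mul_nonneg (by linarith [h.one_le]) (Real.rpow_nonneg hM _))

theorem pos_sub (h : SphereComparison z U kz k p B) (hN : 2 ≤ Module.finrank ℝ E) {a : ℝ}
    (ha : 0 < a) (hP : ∀ x, x ≠ 0 → ‖x‖ ^ 2 ≤ 1 / a → U a x ≤ z x) :
    ∀ x, x ≠ 0 → ‖x‖ ^ 2 < 1 / a → 0 < z x - U a x := by
  have hrank : 1 < Module.rank ℝ E := by
    rw [← Module.finrank_eq_rank]; exact_mod_cast hN
  have hcont : Continuous fun x : E => ‖x‖ ^ 2 := by fun_prop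
  have hopen : IsOpen {x : E | x ≠ 0 ∧ ‖x‖ ^ 2 < 1 / a} :=
    isOpen_ne.inter (isOpen_lt hcont continuous_const)
  have := strong_minimum_principle hopen (isPreconnected_punctured_ball hrank (1 / a))
    (w := fun x => z x - U a x)
    (fun x hx => (h.contDiff_z x hx.1).sub (h.contDiff_U a ha x))
    (fun x hx => sub_nonneg.2 (hP x hx.1 hx.2.le)) ?_ ?_
  · exact fun x hx hxa => this x ⟨hx, hxa⟩
  · intro x hx
    set M := max (z x) (U a x) + 1 with hM
    have hM0 : 0 ≤ M := by
      have := (h.pos_z x hx.1).le.trans (le_max_left _ (U a x))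
      linarith
    refine ⟨B * (p * M ^ (p - 1)), h.coeff_nonneg hM0, ?_⟩
    have hz := (h.contDiff_z x hx.1).continuousAt.eventually
      (gt_mem_nhds (show z x < M by linarith [le_max_left (z x) (U a x)]))
    have hU := (h.contDiff_U a ha x).continuousAt.eventually
      (gt_mem_nhds (show U a x < M by linarith [le_max_right (z x) (U a x)]))
    filter_upwards [hz, hU, hopen.mem_nhds hx] with y hy1 hy2 hy3
    have := h.laplacian_sub_le ha hy3.1 hy3.2.le hy1.le hy2.le
    rwa [abs_of_nonneg (sub_nonneg.2 (hP y hy3.1 hy3.2.le))] at this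
  · obtain ⟨x, hx, hxa, hne⟩ := h.ne a ha
    exact ⟨x, ⟨hx, hxa⟩, lt_of_le_of_ne (sub_nonneg.2 (hP x hx hxa.le))
      (sub_ne_zero.2 hne).symm⟩

/-- Compactness fails at the puncture. There `z - U a` has a positive lower bound `ε`, while joint
continuity keeps `U b` within `ε` of `U a` near `0`. -/
theorem eventually_le_near_zero (h : SphereComparison z U kz k p B) (hN : 2 ≤ Module.finrank ℝ E)
    {a : ℝ} (ha : 0 < a) (hP : ∀ x, x ≠ 0 → ‖x‖ ^ 2 ≤ 1 / a → U a x ≤ z x) :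
    ∃ ρ > 0, ∀ᶠ b in 𝓝 a, ∀ x, x ≠ 0 → ‖x‖ < ρ → U b x ≤ z x := by
  have hpos := h.pos_sub hN ha hP
  obtain ⟨r, hr, hrU⟩ := Metric.nhds_basis_ball.eventually_iff.1
    ((h.contDiff_U a ha 0).continuousAt.eventually
    (gt_mem_nhds (show U a 0 < U a 0 + 1 by linarith)))
  set M := U a 0 + 2 with hM
  have hM0 : 0 ≤ M := by linarith [h.pos_U a ha 0]
  set ρ₀ := min r (Real.sqrt (1 / a)) with hρ₀
  have hρ₀pos : 0 < ρ₀ := by positivity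
  have hsq : ∀ x : E, ‖x‖ < ρ₀ → ‖x‖ ^ 2 < 1 / a := fun x hx =>
    (Real.lt_sqrt (norm_nonneg x)).1 (hx.trans_le (min_le_right _ _))
  obtain ⟨ε, hε, ρ, hρ, hlow⟩ := exists_pos_lower_bound_near_puncture hN
    (w := fun x => z x - U a x) (C := B * (p * M ^ (p - 1))) (ρ₀ := ρ₀) (δ := 1)
    (h.coeff_nonneg hM0) hρ₀pos one_pos
    (fun x hx _ => (h.contDiff_z x (norm_pos_iff.1 hx)).sub (h.contDiff_U a ha x))
    (fun x hx hxρ => hpos x (norm_pos_iff.1 hx) (hsq x hxρ))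
    (fun x hx hxρ hxδ => by
      have h1 : U a x < U a 0 + 1 := hrU (by simpa using hxρ.trans_le (min_le_left _ _))
      have h2 := h.laplacian_sub_le ha (norm_pos_iff.1 hx) (hsq x hxρ).le (M := M)
        (by linarith) (by linarith)
      rwa [abs_of_pos (hpos x (norm_pos_iff.1 hx) (hsq x hxρ))] at h2)
  have hev1 : ∀ᶠ q : ℝ × E in 𝓝 (a, 0), U q.1 q.2 < U a 0 + ε / 2 :=
    (h.continuous_U a ha 0).eventually (gt_mem_nhds (by linarith))
  have hev2 : ∀ᶠ y in 𝓝 (0 : E), U a 0 - ε / 2 < U a y :=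
    (h.contDiff_U a ha 0).continuousAt.eventually (lt_mem_nhds (by linarith))
  rw [nhds_prod_eq] at hev1
  obtain ⟨pa, hpa, pb, hpb, hprod⟩ := eventually_prod_iff.1 hev1
  obtain ⟨r', hr', hball⟩ := Metric.nhds_basis_ball.eventually_iff.1 (hpb.and hev2)
  refine ⟨min r' ρ, by positivity, hpa.mono fun b hb x hx hxr => ?_⟩
  have h1 := hball (x := x) (by simpa using hxr.trans_le (min_le_left _ _))
  have h2 := hprod hb h1.1
  have h3 := hlow x (norm_pos_iff.2 hx) (hxr.trans_le (min_le_right _ _))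
  simp only at h2
  linarith [h1.2]

/-- Openness of the set of good parameters, in three regions: a ball at the puncture, a compact
middle shell on which strict inequality persists, and a thin shell at the moving sphere, where `z -
U b` vanishes on the outer boundary. -/
theorem eventually_le (h : SphereComparison z U kz k p B) (hN : 2 ≤ Module.finrank ℝ E)
    {a : ℝ} (ha : 0 < a) (hP : ∀ x, x ≠ 0 → ‖x‖ ^ 2 ≤ 1 / a → U a x ≤ z x) :
    ∀ᶠ b in 𝓝 a, ∀ x, x ≠ 0 → ‖x‖ ^ 2 ≤ 1 / b → U b x ≤ z x := by
  obtain ⟨ρ, hρ, hzero⟩ := h.eventually_le_near_zero hN ha hP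
  have hcont : Continuous fun x : E => ‖x‖ ^ 2 := by fun_prop
  have hcompact : ∀ s t : ℝ, IsCompact {x : E | s ≤ ‖x‖ ^ 2 ∧ ‖x‖ ^ 2 ≤ t} := by
    intro s t
    refine (isCompact_closedBall (0 : E) (Real.sqrt t)).of_isClosed_subset ?_ ?_
    · exact (isClosed_le continuous_const hcont).inter (isClosed_le hcont continuous_const)
    · intro x hx
      simpa using Real.le_sqrt_of_sq_le hx.2
  have hne : ∀ {s : ℝ} {x : E}, 0 < s → s ≤ ‖x‖ ^ 2 → x ≠ 0 := by
    rintro s x hs hsx rfl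
    simp at hsx; linarith
  obtain ⟨M, hM0, hzM, hUM⟩ : ∃ M ≥ 0, (∀ x : E, 1 / (4 * a) ≤ ‖x‖ ^ 2 → ‖x‖ ^ 2 ≤ 2 / a →
      z x ≤ M) ∧ ∀ b ∈ Icc (a / 2) (2 * a), ∀ x : E, 1 / (4 * a) ≤ ‖x‖ ^ 2 → ‖x‖ ^ 2 ≤ 2 / a →
      U b x ≤ M := by
    obtain ⟨M₁, hM₁⟩ := (hcompact (1 / (4 * a)) (2 / a)).bddAbove_image (f := z)
      fun x hx => (h.contDiff_z x (hne (by positivity) hx.1)).continuousAt.continuousWithinAt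
    obtain ⟨M₂, hM₂⟩ := ((isCompact_Icc (a := a / 2) (b := 2 * a)).prod
      (hcompact (1 / (4 * a)) (2 / a))).bddAbove_image (f := fun q : ℝ × E => U q.1 q.2)
      fun q hq => (h.continuous_U q.1 (by linarith [hq.1.1]) q.2).continuousWithinAt
    refine ⟨max 0 (max M₁ M₂), le_max_left _ _, fun x h1 h2 => ?_, fun b hb x h1 h2 => ?_⟩
    · exact (hM₁ (mem_image_of_mem _ ⟨h1, h2⟩)).trans
        ((le_max_left _ _).trans (le_max_right _ _))
    · exact (hM₂ (mem_image_of_mem (fun q : ℝ × E => U q.1 q.2)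
        (show (b, x) ∈ _ from ⟨hb, h1, h2⟩))).trans
        ((le_max_right _ _).trans (le_max_right _ _))
  -- With `q = 1/(4a)` and `b ≤ 2a`, the outer radius satisfies `1/b ≥ 2q`; as `δ < q`, the thin
  -- shell stays in `‖x‖² ≥ q`, where `M` bounds both functions.
  obtain ⟨δ, hδ, hδq, hnarrow⟩ := exists_narrow_nonneg (E := E) (h.coeff_nonneg hM0)
    (show 0 < 1 / (4 * a) by positivity)
  have hmid : ∀ᶠ b in 𝓝 a, ∀ x ∈ {x : E | ρ ^ 2 ≤ ‖x‖ ^ 2 ∧ ‖x‖ ^ 2 ≤ 1 / a - δ / 2},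
      U b x < z x := by
    refine (hcompact _ _).eventually_forall_of_forall_eventually fun x hx => ?_
    have hx0 : x ≠ 0 := hne (by positivity) hx.1
    have hlt : U a x < z x := sub_pos.1 (h.pos_sub hN ha hP x hx0 (by linarith [hx.2]))
    exact (h.continuous_U a ha x).eventually_lt
      ((h.contDiff_z x hx0).continuousAt.comp (x := (a, x)) (f := Prod.snd) continuousAt_snd) hlt
  have hinv : ContinuousAt (fun b : ℝ => 1 / b) a := by
    simpa using continuousAt_inv₀ ha.ne'
  have hb1 : ∀ᶠ b in 𝓝 a, 1 / b < 1 / a + δ / 2 :=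
    hinv.eventually (gt_mem_nhds (by linarith))
  have hb2 : ∀ᶠ b in 𝓝 a, b ∈ Icc (a / 2) (2 * a) := Icc_mem_nhds (by linarith) (by linarith)
  filter_upwards [hzero, hmid, hb1, hb2] with b hz hm h1 h2 x hx hxb
  have hb : 0 < b := by linarith [h2.1]
  have hbq : 1 / (2 * a) ≤ 1 / b := one_div_le_one_div_of_le hb h2.2
  have hbq' : 1 / b ≤ 2 / a := by
    rw [div_le_div_iff₀ hb ha]; linarith [h2.1]
  have h24 : 1 / (2 * a) = 2 * (1 / (4 * a)) := by field_simp; norm_num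
  have hqpos : 0 < 1 / (4 * a) := by positivity
  have hinner : ∀ y : E, y ≠ 0 → ‖y‖ ^ 2 ≤ 1 / b - δ → U b y ≤ z y := by
    intro y hy hyb
    rcases lt_or_ge ‖y‖ ρ with hyρ | hyρ
    · exact hz y hy hyρ
    · exact (hm y ⟨by gcongr, by linarith⟩).le
  rcases le_or_gt (‖x‖ ^ 2) (1 / b - δ) with hx1 | hx1
  · exact hinner x hx hx1
  refine sub_nonneg.1 (hnarrow (1 / b) (by linarith) (fun y => z y - U b y) ?_ ?_ ?_ ?_ x hx1.le hxb)
  · intro y hy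
    have hy0 : y ≠ 0 := hne (s := 1 / b - δ) (by linarith) hy.1
    exact ((h.contDiff_z y hy0).continuousAt.sub
      (h.contDiff_U b hb y).continuousAt).continuousWithinAt
  · intro y hy
    rw [h.boundary b hb y hy, sub_self]
  · intro y hy
    have hy0 : y ≠ 0 := hne (s := 1 / b - δ) (by linarith) hy.symm.le
    exact sub_nonneg.2 (hinner y hy0 hy.le)
  · intro y hy1 hy2 hneg
    have hy0 : y ≠ 0 := hne (s := 1 / b - δ) (by linarith) hy1.le
    refine ⟨(h.contDiff_z y hy0).sub (h.contDiff_U b hb y), ?_⟩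
    have := h.laplacian_sub_le hb hy0 hy2.le (hzM y (by linarith) (by linarith))
      (hUM b h2 y (by linarith) (by linarith))
    rwa [abs_of_neg hneg] at this

/-- Continuity method on `[a₀, a]`: the spheres shrink towards the puncture and never have to stop.
-/
theorem le_of_le_start (h : SphereComparison z U kz k p B) (hN : 2 ≤ Module.finrank ℝ E)
    {a₀ : ℝ} (ha₀ : 0 < a₀) (hstart : ∀ x, x ≠ 0 → ‖x‖ ^ 2 ≤ 1 / a₀ → U a₀ x ≤ z x) {a : ℝ}
    (ha : a₀ ≤ a) : ∀ x, x ≠ 0 → ‖x‖ ^ 2 ≤ 1 / a → U a x ≤ z x := by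
  set A : Set ℝ := {b | ∀ x, x ≠ 0 → ‖x‖ ^ 2 ≤ 1 / b → U b x ≤ z x} with hA
  have hclosed : IsClosed (A ∩ Icc a₀ a) := by
    refine isClosed_of_closure_subset fun b hb => ?_
    have hbI : b ∈ Icc a₀ a := closure_minimal inter_subset_right isClosed_Icc hb
    refine ⟨fun x hx hxb => ?_, hbI⟩
    have hb0 : 0 < b := ha₀.trans_le hbI.1
    rcases hxb.eq_or_lt with he | hlt
    · exact (h.boundary b hb0 x he).symm.le
    by_contra! hcon
    have h1 : ∀ᶠ c in 𝓝 b, z x < U c x := by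
      have : ContinuousAt (fun c : ℝ => U c x) b :=
        ContinuousAt.comp (f := fun c : ℝ => (c, x)) (h.continuous_U b hb0 x) (by fun_prop)
      exact this.eventually (lt_mem_nhds hcon)
    have h2 : ∀ᶠ c in 𝓝 b, ‖x‖ ^ 2 < 1 / c := by
      have : ContinuousAt (fun c : ℝ => 1 / c) b := by simpa using continuousAt_inv₀ hb0.ne'
      exact this.eventually (lt_mem_nhds hlt)
    obtain ⟨c, ⟨hcA, _⟩, hc1, hc2⟩ := ((mem_closure_iff_frequently.1 hb).and_eventually
      (h1.and h2)).exists
    exact absurd (hcA x hx hc2.le) (not_le.2 hc1)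
  have := hclosed.Icc_subset_of_forall_exists_gt hstart fun b hb y hy => by
    have hev := h.eventually_le hN (ha₀.trans_le hb.2.1) hb.1
    have h1 : ∀ᶠ c in 𝓝[>] b, c ∈ A := hev.filter_mono nhdsWithin_le_nhds
    have h2 : ∀ᶠ c in 𝓝[>] b, c ∈ Ioc b y := Ioc_mem_nhdsGT hy
    obtain ⟨c, hc⟩ := (h1.and h2).exists
    exact ⟨c, hc⟩
  exact this ⟨ha, le_rfl⟩

end SphereComparison

end MovingSpheres

/-! ### Homogeneous functions and the product rule for the Laplacian -/

section Homogeneous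

variable {E W : Type*} [NormedAddCommGroup E] [NormedSpace ℝ E] [NormedAddCommGroup W]
  [NormedSpace ℝ W]

theorem fderiv_smul_of_homogeneous {H : E → W} {r : ℝ}
    (hH : ∀ c : ℝ, 0 < c → ∀ X, H (c • X) = c ^ r • H X) {c : ℝ} (hc : 0 < c) (X : E) :
    fderiv ℝ H (c • X) = c ^ (r - 1) • fderiv ℝ H X := by
  have h1 : fderiv ℝ (fun Y => H (c • Y)) X = c • fderiv ℝ H (c • X) :=
    fderiv_comp_smul c
  have h2 : (fun Y => H (c • Y)) = c ^ r • H := by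
    ext Y; exact hH c hc Y
  rw [h2, fderiv_const_smul_field] at h1
  rw [Real.rpow_sub_one hc.ne', div_eq_inv_mul, mul_smul]
  have h3 : c ^ r • fderiv ℝ H X = c • fderiv ℝ H (c • X) := h1
  rw [h3, smul_smul, inv_mul_cancel₀ hc.ne', one_smul]

theorem fderiv_apply_self_of_homogeneous {H : E → W} {r : ℝ}
    (hH : ∀ c : ℝ, 0 < c → ∀ X, H (c • X) = c ^ r • H X) {X : E}
    (hd : DifferentiableAt ℝ H X) : fderiv ℝ H X X = r • H X := by
  have h1 : HasDerivAt (fun c : ℝ => H (c • X)) (fderiv ℝ H X X) 1 := by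
    have h0 : HasDerivAt (fun c : ℝ => c • X) X 1 := by
      simpa using (hasDerivAt_id (1 : ℝ)).smul_const X
    have hd' : HasFDerivAt H (fderiv ℝ H X) ((1 : ℝ) • X) := by
      rw [one_smul]; exact hd.hasFDerivAt
    exact hd'.comp_hasDerivAt (1 : ℝ) h0
  have h2 : HasDerivAt (fun c : ℝ => c ^ r • H X) (r • H X) 1 := by
    have := (Real.hasDerivAt_rpow_const (x := 1) (p := r) (Or.inl one_ne_zero)).smul_const (H X)
    simpa using this
  have h3 : (fun c : ℝ => H (c • X)) =ᶠ[𝓝 1] fun c : ℝ => c ^ r • H X := by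
    filter_upwards [lt_mem_nhds one_pos] with c hc using hH c hc X
  exact h1.unique (h2.congr_of_eventuallyEq h3)

end Homogeneous

theorem laplacian_smul_of_homogeneous {E : Type*} [NormedAddCommGroup E] [InnerProductSpace ℝ E]
    [FiniteDimensional ℝ E] {F : E → ℝ} {r : ℝ}
    (hF : ∀ c : ℝ, 0 < c → ∀ X, F (c • X) = c ^ r • F X) {c : ℝ} (hc : 0 < c) (X : E) :
    Laplacian.laplacian F (c • X) = c ^ (r - 2) * Laplacian.laplacian F X := by
  have h2 := fderiv_smul_of_homogeneous (H := fderiv ℝ F) (r := r - 1)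
    (fun c hc X => fderiv_smul_of_homogeneous hF hc X) hc X
  rw [laplacian_eq_sum_fderiv (stdOrthonormalBasis ℝ E),
    laplacian_eq_sum_fderiv (stdOrthonormalBasis ℝ E), h2, Finset.mul_sum]
  have : r - 1 - 1 = r - 2 := by ring
  rw [this]
  simp

theorem deriv_deriv_mul {A B : ℝ → ℝ} {x : ℝ} (hA : ContDiffAt ℝ 2 A x) (hB : ContDiffAt ℝ 2 B x) :
    deriv (deriv fun t => A t * B t) x =
      deriv (deriv A) x * B x + 2 * (deriv A x * deriv B x) + A x * deriv (deriv B) x := by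
  have hd : ∀ {f : ℝ → ℝ}, ContDiffAt ℝ 2 f x →
      (∀ᶠ t in 𝓝 x, HasDerivAt f (deriv f t) t) ∧ HasDerivAt (deriv f) (deriv (deriv f) x) x := by
    intro f hf
    refine ⟨(hf.eventually (by simp)).mono fun t ht => (ht.differentiableAt (by simp)).hasDerivAt,
      ?_⟩
    have : ContDiffAt ℝ 1 (deriv f) x := by
      have h := (hf.fderiv_right (m := 1) (by norm_num)).clm_apply (contDiffAt_const (c := (1 : ℝ)))
      simpa only [fderiv_apply_one_eq_deriv] using h
    exact (this.differentiableAt (by simp)).hasDerivAt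
  obtain ⟨hA1, hA2⟩ := hd hA
  obtain ⟨hB1, hB2⟩ := hd hB
  refine deriv_deriv_eq_of_hasDerivAt (g' := fun t => deriv A t * B t + A t * deriv B t) ?_ ?_
  · filter_upwards [hA1, hB1] with t h1 h2 using h1.mul h2
  · refine ((hA2.mul hB1.self_of_nhds).add (hA1.self_of_nhds.mul hB2)).congr_deriv ?_
    ring

theorem laplacian_mul {E : Type*} [NormedAddCommGroup E] [InnerProductSpace ℝ E]
    [FiniteDimensional ℝ E] {ι : Type*} [Fintype ι] (b : OrthonormalBasis ι ℝ E) {f g : E → ℝ}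
    {x : E} (hf : ContDiffAt ℝ 2 f x) (hg : ContDiffAt ℝ 2 g x) :
    Laplacian.laplacian (fun y => f y * g y) x =
      Laplacian.laplacian f x * g x + 2 * ∑ i, fderiv ℝ f x (b i) * fderiv ℝ g x (b i) +
        f x * Laplacian.laplacian g x := by
  have hline : ∀ {h : E → ℝ}, ContDiffAt ℝ 2 h x → ∀ i,
      ContDiffAt ℝ 2 (fun t : ℝ => h (x + t • b i)) 0 ∧
      deriv (fun t : ℝ => h (x + t • b i)) 0 = fderiv ℝ h x (b i) := by
    intro h hh i
    have h0 : x + (0 : ℝ) • b i = x := by simp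
    constructor
    · exact ContDiffAt.comp (f := fun t : ℝ => x + t • b i) 0 (by rwa [h0]) (by fun_prop)
    · have h1 : HasDerivAt (fun t : ℝ => x + t • b i) (b i) 0 := by
        simpa using ((hasDerivAt_id (0 : ℝ)).smul_const (b i)).const_add x
      have h2 : HasFDerivAt h (fderiv ℝ h x) (x + (0 : ℝ) • b i) := by
        rw [h0]; exact (hh.differentiableAt (by simp)).hasFDerivAt
      exact (h2.comp_hasDerivAt (0 : ℝ) h1).deriv
  rw [laplacian_eq_sum_deriv_deriv b (hf.mul hg), laplacian_eq_sum_deriv_deriv b hf,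
    laplacian_eq_sum_deriv_deriv b hg, Finset.sum_mul, Finset.mul_sum, Finset.mul_sum,
    ← Finset.sum_add_distrib, ← Finset.sum_add_distrib]
  refine Finset.sum_congr rfl fun i _ => ?_
  rw [deriv_deriv_mul (hline hf i).1 (hline hg i).1, (hline hf i).2, (hline hg i).2]
  simp

/-! ### Coordinates on `ℝⁿ⁺¹` and homogeneous extensions from the sphere -/

namespace Sph

variable {n : ℕ}

/-- The point of `ℝⁿ⁺¹` with horizontal part `x` and last coordinate `t`. -/
noncomputable def pt (x : EuclideanSpace ℝ (Fin n)) (t : ℝ) : EuclideanSpace ℝ (Fin (n + 1)) :=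
  WithLp.toLp 2 (Fin.snoc (α := fun _ => ℝ) x.ofLp t)

@[simp] theorem pt_castSucc (x : EuclideanSpace ℝ (Fin n)) (t : ℝ) (i : Fin n) :
    pt x t i.castSucc = x i := by simp [pt]

@[simp] theorem pt_last (x : EuclideanSpace ℝ (Fin n)) (t : ℝ) : pt x t (Fin.last n) = t := by
  simp [pt]

theorem ext_coords {X Y : EuclideanSpace ℝ (Fin (n + 1))}
    (h : ∀ i : Fin n, X i.castSucc = Y i.castSucc) (h' : X (Fin.last n) = Y (Fin.last n)) :
    X = Y := by
  ext i
  induction i using Fin.lastCases with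
  | last => exact h'
  | cast i => exact h i

theorem exists_eq_pt (X : EuclideanSpace ℝ (Fin (n + 1))) : ∃ x t, X = pt x t :=
  ⟨WithLp.toLp 2 fun i => X i.castSucc, X (Fin.last n), ext_coords (by simp) (by simp)⟩

theorem pt_add (x y : EuclideanSpace ℝ (Fin n)) (s t : ℝ) :
    pt x s + pt y t = pt (x + y) (s + t) := ext_coords (by simp) (by simp)

theorem smul_pt (c : ℝ) (x : EuclideanSpace ℝ (Fin n)) (t : ℝ) :
    c • pt x t = pt (c • x) (c * t) := ext_coords (by simp) (by simp)

theorem norm_pt_sq (x : EuclideanSpace ℝ (Fin n)) (t : ℝ) :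
    ‖pt x t‖ ^ 2 = ‖x‖ ^ 2 + t ^ 2 := by
  rw [EuclideanSpace.norm_sq_eq, EuclideanSpace.norm_sq_eq, Fin.sum_univ_castSucc]
  simp

theorem lastVec_eq_pt : lastVec n = pt 0 1 := by
  refine ext_coords (fun i => ?_) ?_
  · simp [lastVec, (Fin.castSucc_lt_last i).ne]
  · simp [lastVec]

theorem pt_ne_zero {x : EuclideanSpace ℝ (Fin n)} {t : ℝ} (h : x ≠ 0 ∨ t < 0) : pt x t ≠ 0 := by
  intro h0
  have h1 := norm_pt_sq x t
  rw [h0] at h1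
  simp only [norm_zero, ne_eq, OfNat.ofNat_ne_zero, not_false_eq_true, zero_pow] at h1
  rcases h with h | h
  · have : 0 < ‖x‖ ^ 2 := by positivity
    nlinarith [sq_nonneg t]
  · nlinarith [sq_nonneg ‖x‖]

theorem contDiff_pt {m : ℕ∞ω} {G : Type*} [NormedAddCommGroup G] [NormedSpace ℝ G]
    {f : G → EuclideanSpace ℝ (Fin n)} {g : G → ℝ} (hf : ContDiff ℝ m f) (hg : ContDiff ℝ m g) :
    ContDiff ℝ m fun y => pt (f y) (g y) := by
  rw [contDiff_euclidean]
  intro i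
  induction i using Fin.lastCases with
  | last => simpa using hg
  | cast i => simpa using contDiff_euclidean.1 hf i

theorem continuous_pt : Continuous fun q : EuclideanSpace ℝ (Fin n) × ℝ => pt q.1 q.2 :=
  (contDiff_pt (m := 0) contDiff_fst contDiff_snd).continuous

/-- The radial projection to the sphere. -/
noncomputable def proj (X : EuclideanSpace ℝ (Fin (n + 1))) (hX : X ≠ 0) : Sph n := ⟨‖X‖⁻¹ • X, normalize_mem hX⟩

theorem proj_pt_ne_north {x : EuclideanSpace ℝ (Fin n)} {t : ℝ} (h : x ≠ 0 ∨ t < 0) :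
    proj (pt x t) (pt_ne_zero h) ≠ north n := by
  intro he
  have h1 : ‖pt x t‖⁻¹ • pt x t = lastVec n := congrArg Subtype.val he
  have hn : 0 < ‖pt x t‖ := norm_pos_iff.2 (pt_ne_zero h)
  rw [lastVec_eq_pt, smul_pt] at h1
  rcases h with h | h
  · apply h
    ext i
    have := congrArg (fun Y : EuclideanSpace ℝ (Fin (n + 1)) => Y i.castSucc) h1
    simpa [hn.ne'] using this
  · have := congrArg (fun Y : EuclideanSpace ℝ (Fin (n + 1)) => Y (Fin.last n)) h1
    simp only [pt_last] at this
    have : ‖pt x t‖⁻¹ * t < 0 := mul_neg_of_pos_of_neg (by positivity) h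
    linarith

theorem radialExt_eq (f : Sph n → ℝ) {X : EuclideanSpace ℝ (Fin (n + 1))} (hX : X ≠ 0) :
    radialExt f X = f (proj X hX) := by
  unfold radialExt
  rw [dif_pos hX]
  rfl

theorem radialExt_smul (f : Sph n → ℝ) {c : ℝ} (hc : 0 < c)
    (X : EuclideanSpace ℝ (Fin (n + 1))) : radialExt f (c • X) = radialExt f X := by
  by_cases hX : X = 0
  · simp [hX]
  · rw [radialExt_eq f hX, radialExt_eq f (smul_ne_zero hc.ne' hX)]
    congr 1
    ext1
    simp only [proj]
    rw [norm_smul, Real.norm_of_nonneg hc.le, smul_smul]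
    congr 1
    field_simp

/-- Passage from manifold smoothness to Euclidean smoothness: radial projection is smooth as a map
from the open submanifold `{0}ᶜ` to the sphere. -/
theorem contDiffAt_radialExt {m : ℕ∞ω} {f : Sph n → ℝ} {X : EuclideanSpace ℝ (Fin (n + 1))}
    (hX : X ≠ 0) (hf : ContMDiffAt (𝓡 n) 𝓘(ℝ, ℝ) m f (proj X hX)) :
    ContDiffAt ℝ m (radialExt f) X := by
  set O : TopologicalSpace.Opens (EuclideanSpace ℝ (Fin (n + 1))) := ⟨{0}ᶜ, isOpen_compl_singleton⟩
  have hg : ContMDiff 𝓘(ℝ, EuclideanSpace ℝ (Fin (n + 1))) 𝓘(ℝ, EuclideanSpace ℝ (Fin (n + 1))) m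
      (fun Y : O => ‖(Y : EuclideanSpace ℝ (Fin (n + 1)))‖⁻¹ •
        (Y : EuclideanSpace ℝ (Fin (n + 1)))) := by
    intro Y
    have hY : (Y : EuclideanSpace ℝ (Fin (n + 1))) ≠ 0 := Y.2
    have h1 : ContDiffAt ℝ m (fun Y : EuclideanSpace ℝ (Fin (n + 1)) => ‖Y‖⁻¹ • Y)
        (Y : EuclideanSpace ℝ (Fin (n + 1))) :=
      ((contDiffAt_norm ℝ hY).inv (norm_ne_zero_iff.2 hY)).smul contDiffAt_id
    exact contMDiffAt_subtype_iff.2 h1.contMDiffAt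
  have : Fact (Module.finrank ℝ (EuclideanSpace ℝ (Fin (n + 1))) = n + 1) := ⟨by simp⟩
  have hO : ∀ Y : O, (Y : EuclideanSpace ℝ (Fin (n + 1))) ≠ 0 := fun Y => Y.2
  have hp := hg.codRestrict_sphere (n := n) (fun Y => normalize_mem (hO Y))
  have hcomp : ContMDiffAt 𝓘(ℝ, EuclideanSpace ℝ (Fin (n + 1))) 𝓘(ℝ, ℝ) m
      (fun Y : O => radialExt f Y) ⟨X, hX⟩ := by
    have h1 := ContMDiffAt.comp (x := (⟨X, hX⟩ : O)) (g := f) hf (hp ⟨X, hX⟩)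
    refine h1.congr_of_eventuallyEq (Eventually.of_forall fun Y => ?_)
    exact radialExt_eq f (hO Y)
  exact (contMDiffAt_subtype_iff.1 hcomp).contDiffAt

/-- The extension of a function on `𝕊ⁿ` that is homogeneous of degree `s`. -/
noncomputable def homExt (s : ℝ) (f : Sph n → ℝ) (X : EuclideanSpace ℝ (Fin (n + 1))) : ℝ :=
  ‖X‖ ^ s * radialExt f X

theorem homExt_smul (s : ℝ) (f : Sph n → ℝ) (c : ℝ) (hc : 0 < c)
    (X : EuclideanSpace ℝ (Fin (n + 1))) : homExt s f (c • X) = c ^ s • homExt s f X := by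
  rw [homExt, homExt, radialExt_smul f hc, norm_smul, Real.norm_of_nonneg hc.le,
    Real.mul_rpow hc.le (norm_nonneg X), smul_eq_mul, mul_assoc]

theorem homExt_eq_of_norm_eq_one (s : ℝ) (f : Sph n → ℝ) (θ : Sph n) :
    homExt s f (θ : EuclideanSpace ℝ (Fin (n + 1))) = f θ := by
  rw [homExt, radialExt_coe, norm_eq_of_mem_sphere θ, Real.one_rpow, one_mul]

theorem homExt_eq (s : ℝ) (f : Sph n → ℝ) {X : EuclideanSpace ℝ (Fin (n + 1))} (hX : X ≠ 0) :
    homExt s f X = ‖X‖ ^ s * f (proj X hX) := by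
  rw [homExt, radialExt_eq f hX]

theorem contDiffAt_homExt {m : ℕ∞ω} {s : ℝ} {f : Sph n → ℝ} {X : EuclideanSpace ℝ (Fin (n + 1))}
    (hX : X ≠ 0) (hf : ContMDiffAt (𝓡 n) 𝓘(ℝ, ℝ) m f (proj X hX)) :
    ContDiffAt ℝ m (homExt s f) X :=
  (((contDiffAt_norm ℝ hX)).rpow_const_of_ne (norm_ne_zero_iff.2 hX)).mul
    (contDiffAt_radialExt hX hf)

theorem eq_norm_smul_proj {X : EuclideanSpace ℝ (Fin (n + 1))} (hX : X ≠ 0) :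
    X = ‖X‖ • (proj X hX : EuclideanSpace ℝ (Fin (n + 1))) := by
  simp [proj, smul_smul, hX]

/-- Product rule for `‖X‖ ^ s * radialExt f X`. The cross term vanishes because the gradient of the
first factor is radial and the second is constant along rays; the power contributes `s(s + n - 1)`.
-/
theorem laplacian_homExt_coe {s : ℝ} {f : Sph n → ℝ} {θ : Sph n}
    (hf : ContMDiffAt (𝓡 n) 𝓘(ℝ, ℝ) 2 f θ) :
    Laplacian.laplacian (homExt s f) (θ : EuclideanSpace ℝ (Fin (n + 1))) =
      laplaceBeltrami f θ + s * (s + n - 1) * f θ := by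
  set X : EuclideanSpace ℝ (Fin (n + 1)) := (θ : EuclideanSpace ℝ (Fin (n + 1))) with hXdef
  have hn : ‖X‖ = 1 := norm_eq_of_mem_sphere θ
  have hX : X ≠ 0 := ne_zero_of_mem_unit_sphere θ
  have hproj : proj X hX = θ := by ext1; simp [proj, hXdef]
  have hG : ContDiffAt ℝ 2 (radialExt f) X := contDiffAt_radialExt hX (by rwa [hproj])
  have hA : ContDiffAt ℝ 2 (fun Y : EuclideanSpace ℝ (Fin (n + 1)) => ‖Y‖ ^ s) X :=
    (contDiffAt_norm ℝ hX).rpow_const_of_ne (norm_ne_zero_iff.2 hX)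
  have hpow : (fun Y : EuclideanSpace ℝ (Fin (n + 1)) => ‖Y‖ ^ s) =
      fun Y => (‖Y - 0‖ ^ 2) ^ (s / 2) := by
    ext Y
    rw [sub_zero, ← Real.rpow_natCast, ← Real.rpow_mul (norm_nonneg Y)]
    congr 1; push_cast; ring
  have hn2 : ‖X - 0‖ ^ 2 = 1 := by simp [hn]
  have hder : ∀ t : ℝ, t ≠ 0 → ∀ r : ℝ, HasDerivAt (fun t : ℝ => t ^ r) (r * t ^ (r - 1)) t :=
    fun t ht r => Real.hasDerivAt_rpow_const (Or.inl ht)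
  have hΔA : Laplacian.laplacian (fun Y : EuclideanSpace ℝ (Fin (n + 1)) => ‖Y‖ ^ s) X =
      s * (s + n - 1) := by
    rw [hpow, laplacian_radial X 0 (φ := fun t => t ^ (s / 2))
      (φ' := fun t => s / 2 * t ^ (s / 2 - 1)) (c := s / 2 * (s / 2 - 1))]
    · rw [hn2]; simp; ring
    · rw [hn2]; exact Real.contDiffAt_rpow_const_of_ne one_ne_zero
    · rw [hn2]
      filter_upwards [lt_mem_nhds one_pos] with t ht using hder t ht.ne' _
    · rw [hn2]
      exact ((hder 1 one_ne_zero (s / 2 - 1)).const_mul (s / 2)).congr_deriv (by simp)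
  have hDA : fderiv ℝ (fun Y : EuclideanSpace ℝ (Fin (n + 1)) => ‖Y‖ ^ s) X = s • innerSL ℝ X := by
    have h1 : HasFDerivAt (fun Y : EuclideanSpace ℝ (Fin (n + 1)) => ‖Y‖ ^ 2)
        (2 • innerSL ℝ X) X := (hasStrictFDerivAt_norm_sq X).hasFDerivAt
    have h2 := (hder (‖X‖ ^ 2) (by simp [hn]) (s / 2)).comp_hasFDerivAt X h1
    have h3 : (fun Y : EuclideanSpace ℝ (Fin (n + 1)) => ‖Y‖ ^ s) =
        (fun t : ℝ => t ^ (s / 2)) ∘ fun Y : EuclideanSpace ℝ (Fin (n + 1)) => ‖Y‖ ^ 2 := by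
      rw [hpow]; ext Y; simp
    rw [h3, h2.fderiv, hn]
    ext Y; simp; ring
  have hEuler : fderiv ℝ (radialExt f) X X = 0 := by
    have := fderiv_apply_self_of_homogeneous (H := radialExt f) (r := 0) (X := X)
      (fun c hc Y => by simp [radialExt_smul f hc Y]) (hG.differentiableAt (by simp))
    simpa using this
  set b := stdOrthonormalBasis ℝ (EuclideanSpace ℝ (Fin (n + 1)))
  have hsum : ∑ i, fderiv ℝ (fun Y : EuclideanSpace ℝ (Fin (n + 1)) => ‖Y‖ ^ s) X (b i) *
      fderiv ℝ (radialExt f) X (b i) = 0 := by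
    have h1 : ∀ i, fderiv ℝ (fun Y : EuclideanSpace ℝ (Fin (n + 1)) => ‖Y‖ ^ s) X (b i) *
      fderiv ℝ (radialExt f) X (b i) =
        s * fderiv ℝ (radialExt f) X (inner ℝ (b i) X • b i) := by
      intro i
      rw [hDA]; simp [real_inner_comm X]; ring
    rw [Finset.sum_congr rfl fun i _ => h1 i, ← Finset.mul_sum, ← map_sum, b.sum_repr' X, hEuler,
      mul_zero]
  have := laplacian_mul b hA hG
  rw [hsum, hΔA, hn, Real.one_rpow] at this
  rw [show homExt s f = fun Y => ‖Y‖ ^ s * radialExt f Y from rfl, this, laplaceBeltrami,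
    ← hXdef, show radialExt f X = f θ from radialExt_coe f θ]
  ring

end Sph

/-! ### Conformal covariance of the Laplacian under the quadric maps -/

namespace Sph

variable {n : ℕ}

theorem laplacian_eq_sum_horizontal_add_vertical (F : EuclideanSpace ℝ (Fin (n + 1)) → ℝ)
    (Y : EuclideanSpace ℝ (Fin (n + 1))) :
    Laplacian.laplacian F Y =
      ∑ i : Fin n, fderiv ℝ (fderiv ℝ F) Y (pt (EuclideanSpace.single i 1) 0)
        (pt (EuclideanSpace.single i 1) 0) + fderiv ℝ (fderiv ℝ F) Y (pt 0 1) (pt 0 1) := by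
  rw [laplacian_eq_sum_fderiv (EuclideanSpace.basisFun (Fin (n + 1)) ℝ), Fin.sum_univ_castSucc]
  have h1 : ∀ i : Fin n, EuclideanSpace.basisFun (Fin (n + 1)) ℝ i.castSucc =
      pt (EuclideanSpace.single i 1) 0 := by
    intro i
    refine ext_coords (fun j => ?_) ?_
    · simp
    · simp [(Fin.castSucc_lt_last i).ne']
  have h2 : EuclideanSpace.basisFun (Fin (n + 1)) ℝ (Fin.last n) = pt 0 1 := by
    rw [← lastVec_eq_pt]; simp [lastVec]
  simp only [h1, h2]

/-- The inverse stereographic projection `x ↦ (2x, |x|² - 1)`, up to scaling, followed by the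
conformal map of the sphere with parameter `a`. -/
noncomputable def quadric (a : ℝ) (x : EuclideanSpace ℝ (Fin n)) : EuclideanSpace ℝ (Fin (n + 1)) :=
  pt ((2 : ℝ) • x) (a * ‖x‖ ^ 2 - 1 / a)

theorem contDiff_quadric {m : ℕ∞ω} (a : ℝ) :
    ContDiff ℝ m (quadric a : EuclideanSpace ℝ (Fin n) → _) :=
  contDiff_pt (contDiff_id.const_smul _)
    ((contDiff_const.mul (contDiff_id.norm_sq ℝ)).sub contDiff_const)

/-- The chain rule gives four times the horizontal second derivatives plus mixed, vertical and
first-order terms. Euler's identity for `DF`, homogeneous of degree `-n/2`, turns these extra terms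
into exactly four times the vertical second derivative. -/
theorem laplacian_comp_quadric {F : EuclideanSpace ℝ (Fin (n + 1)) → ℝ} {a : ℝ} (ha : a ≠ 0)
    (hF : ∀ c : ℝ, 0 < c → ∀ X, F (c • X) = c ^ (-(((n : ℝ) - 2) / 2)) • F X)
    (x : EuclideanSpace ℝ (Fin n)) (hC : ContDiffAt ℝ 2 F (quadric a x)) :
    Laplacian.laplacian (fun y => F (quadric a y)) x =
      4 * Laplacian.laplacian F (quadric a x) := by
  set Y := quadric a x with hY
  set e : EuclideanSpace ℝ (Fin (n + 1)) := pt 0 1 with he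
  set D := fderiv ℝ F Y with hD
  set H := fderiv ℝ (fderiv ℝ F) Y with hH
  have hcomp : ContDiffAt ℝ 2 (fun y => F (quadric a y)) x :=
    ContDiffAt.comp x hC (contDiff_quadric a).contDiffAt
  have hsymm : ∀ u v, H u v = H v u := by
    have := hC.isSymmSndFDerivAt (by simp)
    exact fun u v => this.eq u v
  have hEuler : H Y = (-((n : ℝ) / 2)) • D := by
    have hfd : ContDiffAt ℝ 1 (fderiv ℝ F) Y := hC.fderiv_right (by norm_num)
    have := fderiv_apply_self_of_homogeneous (H := fderiv ℝ F)
      (fun c hc X => fderiv_smul_of_homogeneous hF hc X) (hfd.differentiableAt (by simp))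
    rw [this]
    congr 1; ring
  set E : Fin n → EuclideanSpace ℝ (Fin (n + 1)) := fun i => pt (EuclideanSpace.single i 1) 0
    with hE
  have hline : ∀ (i : Fin n) (t : ℝ),
      quadric a (x + t • EuclideanSpace.basisFun (Fin n) ℝ i) =
        Y + t • ((2 : ℝ) • E i + (2 * a * x i) • e) + t ^ 2 • (a • e) := by
    intro i t
    have hn : ‖x + t • EuclideanSpace.single i (1 : ℝ)‖ ^ 2 = ‖x‖ ^ 2 + 2 * t * x i + t ^ 2 := by
      rw [norm_add_sq_real, norm_smul, inner_smul_right, EuclideanSpace.inner_single_right]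
      simp; ring
    simp only [hY, hE, he, quadric, EuclideanSpace.basisFun_apply, hn, smul_pt, pt_add]
    congr 1
    · ext j; simp; ring_nf
    · ring
  have hterm : ∀ i : Fin n,
      deriv (deriv fun t : ℝ => F (quadric a (x + t • EuclideanSpace.basisFun (Fin n) ℝ i))) 0 =
        4 * H (E i) (E i) + 8 * a * H (x i • E i) e + 4 * a ^ 2 * (x i) ^ 2 * H e e +
          2 * a * D e := by
    intro i
    simp only [hline]
    rw [deriv_deriv_comp_quadratic hC]
    simp only [← hH, ← hD, map_add, map_smul, add_apply,
      smul_apply, smul_eq_mul]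
    rw [hsymm e (E i)]
    ring
  have hsumE : ∑ i, x i • E i = pt x 0 := by
    refine ext_coords (fun j => ?_) ?_
    · simp [hE]
    · simp [hE]
  have hx2 : ∑ i, (x i) ^ 2 = ‖x‖ ^ 2 := (EuclideanSpace.real_norm_sq_eq x).symm
  have hYe : 2 * H (pt x 0) e + (a * ‖x‖ ^ 2 - 1 / a) * H e e = -((n : ℝ) / 2) * D e := by
    have h1 : Y = (2 : ℝ) • pt x 0 + (a * ‖x‖ ^ 2 - 1 / a) • e := by
      rw [hY, he, smul_pt, smul_pt, pt_add, quadric]; simp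
    have h2 := congrArg (fun T : EuclideanSpace ℝ (Fin (n + 1)) →L[ℝ] ℝ => T e) hEuler
    rw [h1] at h2
    simpa using h2
  rw [laplacian_eq_sum_deriv_deriv (EuclideanSpace.basisFun (Fin n) ℝ) hcomp,
    Finset.sum_congr rfl fun i _ => hterm i, laplacian_eq_sum_horizontal_add_vertical]
  simp only [Finset.sum_add_distrib, ← Finset.mul_sum, ← Finset.sum_mul, hx2]
  have h3 : ∑ i, H (x i • E i) e = H (pt x 0) e := by
    rw [← hsumE, map_sum, sum_apply]
  rw [h3]
  simp only [Finset.sum_const, Finset.card_univ, Fintype.card_fin, nsmul_eq_mul]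
  -- Eliminating the mixed term also cancels the acceleration term `2 a n D e`; this is what fixes
  -- the conformal weight.
  have h4 : 8 * a * H (pt x 0) e =
      4 * a * (-((n : ℝ) / 2) * D e - (a * ‖x‖ ^ 2 - 1 / a) * H e e) := by
    rw [← hYe]; ring
  have h5 : a * (1 / a) = 1 := by field_simp
  rw [h4]
  linear_combination (4 * H e e) * h5

end Sph

/-! ### Monotonicity of `K` and the transformed equations -/

namespace Sph

variable {n : ℕ}

theorem hasDerivAt_comp_pt {F : EuclideanSpace ℝ (Fin (n + 1)) → ℝ} {x : EuclideanSpace ℝ (Fin n)}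
    {t : ℝ} (hF : DifferentiableAt ℝ F (pt x t)) :
    HasDerivAt (fun t => F (pt x t)) (fderiv ℝ F (pt x t) (pt 0 1)) t := by
  have h1 : HasDerivAt (fun t : ℝ => pt x 0 + t • pt (0 : EuclideanSpace ℝ (Fin n)) 1)
      (pt 0 1) t := by
    simpa using ((hasDerivAt_id t).smul_const _).const_add (pt x 0)
  have h2 : ∀ t : ℝ, pt x 0 + t • pt (0 : EuclideanSpace ℝ (Fin n)) 1 = pt x t := fun t => by
    rw [smul_pt, pt_add]; simp
  simp only [h2] at h1
  exact hF.hasFDerivAt.comp_hasDerivAt t h1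

theorem differentiableAt_radialExt {K : Sph n → ℝ} (hK : ContMDiff (𝓡 n) 𝓘(ℝ, ℝ) 1 K)
    {X : EuclideanSpace ℝ (Fin (n + 1))} (hX : X ≠ 0) : DifferentiableAt ℝ (radialExt K) X :=
  (contDiffAt_radialExt hX (hK _)).differentiableAt (by simp)

/-- `dHeight` differs from a multiple of the vertical vector by a radial vector, which the extension
constant along rays does not see. -/
theorem dirDeriv_dHeight {K : Sph n → ℝ} (hK : ContMDiff (𝓡 n) 𝓘(ℝ, ℝ) 1 K) (θ : Sph n) :
    dirDeriv K θ (dHeight θ) = (1 - height θ ^ 2)⁻¹ *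
      fderiv ℝ (radialExt K) (θ : EuclideanSpace ℝ (Fin (n + 1))) (pt 0 1) := by
  have h0 := fderiv_apply_self_of_homogeneous (H := radialExt K) (r := 0)
    (fun c hc Y => by simp [radialExt_smul K hc Y])
    (differentiableAt_radialExt hK (ne_zero_of_mem_unit_sphere θ))
  rw [dirDeriv, dHeight, map_smul, map_sub, map_smul, h0, lastVec_eq_pt]
  simp

theorem fderiv_radialExt_vertical_nonneg {K : Sph n → ℝ} (hK : ContMDiff (𝓡 n) 𝓘(ℝ, ℝ) 1 K)
    (hK_nonneg : ∀ θ : Sph n, θ ≠ north n → θ ≠ south n → 0 ≤ dirDeriv K θ (dHeight θ))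
    {x : EuclideanSpace ℝ (Fin n)} (hx : x ≠ 0) (t : ℝ) :
    0 ≤ fderiv ℝ (radialExt K) (pt x t) (pt 0 1) := by
  have hX : pt x t ≠ 0 := pt_ne_zero (Or.inl hx)
  have hn : 0 < ‖pt x t‖ := norm_pos_iff.2 hX
  set θ := proj (pt x t) hX with hθ
  have hcoe : (θ : EuclideanSpace ℝ (Fin (n + 1))) = pt (‖pt x t‖⁻¹ • x) (‖pt x t‖⁻¹ * t) := by
    rw [← smul_pt]; rfl
  have hpole : ∀ σ : ℝ, (θ : EuclideanSpace ℝ (Fin (n + 1))) ≠ pt 0 σ := by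
    intro σ h
    rw [hcoe] at h
    apply hx
    ext i
    have := congrArg (fun Y : EuclideanSpace ℝ (Fin (n + 1)) => Y i.castSucc) h
    simpa [hX] using this
  have h1 := hK_nonneg θ
    (fun h => hpole 1 (by rw [h]; exact lastVec_eq_pt))
    (fun h => hpole (-1) (by
      rw [h]; change -lastVec n = _
      rw [lastVec_eq_pt, ← neg_one_smul ℝ (pt (0 : EuclideanSpace ℝ (Fin n)) 1), smul_pt]; simp))
  rw [dirDeriv_dHeight hK] at h1
  have hpos : 0 < 1 - height θ ^ 2 := by
    have h2 : ‖(θ : EuclideanSpace ℝ (Fin (n + 1)))‖ ^ 2 = 1 := by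
      rw [norm_eq_of_mem_sphere]; norm_num
    rw [hcoe, norm_pt_sq] at h2
    have h3 : height θ = ‖pt x t‖⁻¹ * t := by rw [height, hcoe, pt_last]
    have h4 : 0 < ‖‖pt x t‖⁻¹ • x‖ ^ 2 := by
      have : ‖pt x t‖⁻¹ • x ≠ 0 := smul_ne_zero (inv_ne_zero hn.ne') hx
      positivity
    rw [h3]; linarith
  have h2 : 0 ≤ fderiv ℝ (radialExt K) (θ : EuclideanSpace ℝ (Fin (n + 1))) (pt 0 1) := by
    by_contra! hneg
    exact absurd h1 (not_le.2 (mul_neg_of_pos_of_neg (inv_pos.2 hpos) hneg))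
  rw [eq_norm_smul_proj hX, fderiv_smul_of_homogeneous (H := radialExt K) (r := 0)
    (fun c hc Y => by simp [radialExt_smul K hc Y]) hn]
  exact mul_nonneg (Real.rpow_nonneg hn.le _) h2

theorem monotone_radialExt {K : Sph n → ℝ} (hK : ContMDiff (𝓡 n) 𝓘(ℝ, ℝ) 1 K)
    (hK_nonneg : ∀ θ : Sph n, θ ≠ north n → θ ≠ south n → 0 ≤ dirDeriv K θ (dHeight θ))
    {x : EuclideanSpace ℝ (Fin n)} (hx : x ≠ 0) : Monotone fun t => radialExt K (pt x t) :=
  monotone_of_hasDerivAt_nonneg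
    (fun _ => hasDerivAt_comp_pt (differentiableAt_radialExt hK (pt_ne_zero (Or.inl hx))))
    (fderiv_radialExt_vertical_nonneg hK hK_nonneg hx)

theorem exists_abs_radialExt_le {K : Sph n → ℝ} (hK : ContMDiff (𝓡 n) 𝓘(ℝ, ℝ) 1 K) :
    ∃ B, ∀ X, X ≠ 0 → |radialExt K X| ≤ B := by
  obtain ⟨B, hB⟩ := (isCompact_univ (X := Sph n)).exists_bound_of_continuousOn
    hK.continuous.continuousOn
  refine ⟨B, fun X hX => ?_⟩
  rw [radialExt_eq K hX]
  exact hB _ (mem_univ _)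

theorem exists_fderiv_radialExt_vertical_ne {K : Sph n → ℝ} (hK : ContMDiff (𝓡 n) 𝓘(ℝ, ℝ) 1 K)
    (hK_ne : ∃ θ : Sph n, θ ≠ north n ∧ θ ≠ south n ∧ dirDeriv K θ (dHeight θ) ≠ 0) :
    ∃ (x : EuclideanSpace ℝ (Fin n)) (t : ℝ), x ≠ 0 ∧
      fderiv ℝ (radialExt K) (pt x t) (pt 0 1) ≠ 0 := by
  obtain ⟨θ, hN, hS, hne⟩ := hK_ne
  rw [dirDeriv_dHeight hK] at hne
  obtain ⟨x, t, hxt⟩ := exists_eq_pt (θ : EuclideanSpace ℝ (Fin (n + 1)))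
  refine ⟨x, t, ?_, ?_⟩
  · rintro rfl
    have h1 : ‖(θ : EuclideanSpace ℝ (Fin (n + 1)))‖ ^ 2 = 1 := by
      rw [norm_eq_of_mem_sphere]; norm_num
    rw [hxt, norm_pt_sq] at h1
    have h2 : t = 1 ∨ t = -1 := by
      rw [← sq_eq_one_iff]; simpa using h1
    rcases h2 with rfl | rfl
    · exact hN (Subtype.ext (by rw [hxt]; exact lastVec_eq_pt.symm))
    · refine hS (Subtype.ext ?_)
      rw [hxt]; change _ = -lastVec n
      rw [lastVec_eq_pt, ← neg_one_smul ℝ (pt (0 : EuclideanSpace ℝ (Fin n)) 1), smul_pt]; simp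
  · rw [← hxt]
    exact right_ne_zero_of_mul hne

/-- The extension of a function on `𝕊ⁿ` whose degree of homogeneity is the conformal weight. -/
noncomputable def confExt (v : Sph n → ℝ) : EuclideanSpace ℝ (Fin (n + 1)) → ℝ :=
  homExt (-(((n : ℝ) - 2) / 2)) v

theorem confExt_smul (v : Sph n → ℝ) (c : ℝ) (hc : 0 < c) (X : EuclideanSpace ℝ (Fin (n + 1))) :
    confExt v (c • X) = c ^ (-(((n : ℝ) - 2) / 2)) • confExt v X := homExt_smul _ v c hc X

theorem contDiffAt_confExt {v : Sph n → ℝ}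
    (hv : ContMDiffOn (𝓡 n) 𝓘(ℝ, ℝ) 2 v {north n}ᶜ) {x : EuclideanSpace ℝ (Fin n)} {t : ℝ}
    (h : x ≠ 0 ∨ t < 0) : ContDiffAt ℝ 2 (confExt v) (pt x t) :=
  contDiffAt_homExt (pt_ne_zero h)
    (hv.contMDiffAt (isOpen_compl_singleton.mem_nhds (proj_pt_ne_north h)))

theorem confExt_pos {K v : Sph n → ℝ} (hsol : IsPosSolution K v) {x : EuclideanSpace ℝ (Fin n)}
    {t : ℝ} (h : x ≠ 0 ∨ t < 0) : 0 < confExt v (pt x t) := by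
  rw [confExt, homExt_eq _ v (pt_ne_zero h)]
  exact mul_pos (Real.rpow_pos_of_pos (norm_pos_iff.2 (pt_ne_zero h)) _)
    (hsol _ (proj_pt_ne_north h)).1

/-- The critical exponent makes both sides homogeneous of the same degree: `-(n-2)/2 · (n+2)/(n-2) =
-(n-2)/2 - 2`. On the sphere, `s(s + n - 1) = -n(n-2)/4` for `s = -(n-2)/2`. -/
theorem laplacian_confExt (hn : 3 ≤ n) {K v : Sph n → ℝ}
    (hv : ContMDiffOn (𝓡 n) 𝓘(ℝ, ℝ) 2 v {north n}ᶜ) (hsol : IsPosSolution K v)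
    {x : EuclideanSpace ℝ (Fin n)} {t : ℝ} (h : x ≠ 0 ∨ t < 0) :
    Laplacian.laplacian (confExt v) (pt x t) =
      -(radialExt K (pt x t) * confExt v (pt x t) ^ (((n : ℝ) + 2) / ((n : ℝ) - 2))) := by
  have hX := pt_ne_zero h
  have hθ := proj_pt_ne_north h
  have hnorm : 0 < ‖pt x t‖ := norm_pos_iff.2 hX
  obtain ⟨hpos, heq⟩ := hsol _ hθ
  have hn' : (3 : ℝ) ≤ n := by exact_mod_cast hn
  have h1 : Laplacian.laplacian (confExt v) (pt x t) = ‖pt x t‖ ^ (-(((n : ℝ) - 2) / 2) - 2) *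
      Laplacian.laplacian (confExt v)
        (proj (pt x t) hX : EuclideanSpace ℝ (Fin (n + 1))) := by
    conv_lhs => rw [eq_norm_smul_proj hX]
    exact laplacian_smul_of_homogeneous (confExt_smul v) hnorm _
  have h2 : Laplacian.laplacian (confExt v) (proj (pt x t) hX : EuclideanSpace ℝ (Fin (n + 1))) =
      conformalLaplacian v (proj (pt x t) hX) := by
    rw [confExt, laplacian_homExt_coe (hv.contMDiffAt (isOpen_compl_singleton.mem_nhds hθ)),
      conformalLaplacian]
    ring
  have h3 : (‖pt x t‖ ^ (-(((n : ℝ) - 2) / 2))) ^ (((n : ℝ) + 2) / ((n : ℝ) - 2)) =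
      ‖pt x t‖ ^ (-(((n : ℝ) - 2) / 2) - 2) := by
    rw [← Real.rpow_mul hnorm.le]
    congr 1
    have : (n : ℝ) - 2 ≠ 0 := by linarith
    field_simp
    ring
  rw [h1, h2, confExt, homExt_eq _ v hX, radialExt_eq K hX,
    Real.mul_rpow (Real.rpow_nonneg hnorm.le _) hpos.le, h3]
  linear_combination -(‖pt x t‖ ^ (-(((n : ℝ) - 2) / 2) - 2)) * heq

theorem quadric_regular {a : ℝ} {x : EuclideanSpace ℝ (Fin n)} (h : x ≠ 0 ∨ 0 < a) :
    (2 : ℝ) • x ≠ 0 ∨ a * ‖x‖ ^ 2 - 1 / a < 0 := by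
  by_cases hx : x = 0
  · right
    have ha : 0 < a := by simpa [hx] using h
    have : 0 < 1 / a := by positivity
    simp only [hx, norm_zero]
    linarith
  · exact Or.inl (smul_ne_zero two_ne_zero hx)

theorem laplacian_confExt_quadric (hn : 3 ≤ n) {K v : Sph n → ℝ}
    (hv : ContMDiffOn (𝓡 n) 𝓘(ℝ, ℝ) 2 v {north n}ᶜ) (hsol : IsPosSolution K v) {a : ℝ}
    (ha : a ≠ 0) {x : EuclideanSpace ℝ (Fin n)} (h : x ≠ 0 ∨ 0 < a) :
    Laplacian.laplacian (fun y => confExt v (quadric a y)) x =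
      -(4 * radialExt K (quadric a x) *
        confExt v (quadric a x) ^ (((n : ℝ) + 2) / ((n : ℝ) - 2))) := by
  have hr := quadric_regular h
  rw [laplacian_comp_quadric ha (confExt_smul v) x (contDiffAt_confExt hv hr), quadric,
    laplacian_confExt hn hv hsol hr]
  ring

/-- With `r = ‖x‖²` these are the last coordinates of `quadric a x` and `quadric (-1) x`, whose
horizontal parts coincide. -/
theorem vertical_le {a : ℝ} (ha : 0 < a) {r : ℝ} (hr : r ≤ 1 / a) :
    a * r - 1 / a ≤ -1 * r - 1 / -1 := by
  have h1 : (a + 1) * r ≤ (a + 1) * (1 / a) := by gcongr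
  have h2 : (a + 1) * (1 / a) = 1 + 1 / a := by field_simp
  linarith

/-- If the two solutions agreed, so would their coefficients, and monotonicity would make `K`
constant on the vertical segments between the two points. Rescaled, segments near `x = 0` exhaust
whole vertical lines, so the vertical derivative of `K` would vanish. -/
theorem exists_confExt_quadric_ne (hn : 3 ≤ n) {K v : Sph n → ℝ}
    (hK : ContMDiff (𝓡 n) 𝓘(ℝ, ℝ) 1 K)
    (hK_nonneg : ∀ θ : Sph n, θ ≠ north n → θ ≠ south n → 0 ≤ dirDeriv K θ (dHeight θ))
    (hK_ne : ∃ θ : Sph n, θ ≠ north n ∧ θ ≠ south n ∧ dirDeriv K θ (dHeight θ) ≠ 0)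
    (hv : ContMDiffOn (𝓡 n) 𝓘(ℝ, ℝ) 2 v {north n}ᶜ) (hsol : IsPosSolution K v) {a : ℝ}
    (ha : 0 < a) : ∃ x, x ≠ 0 ∧ ‖x‖ ^ 2 < 1 / a ∧
      confExt v (quadric (-1) x) ≠ confExt v (quadric a x) := by
  by_contra! hcon
  have hcont : Continuous fun x : EuclideanSpace ℝ (Fin n) => ‖x‖ ^ 2 := by fun_prop
  have hopen : IsOpen {x : EuclideanSpace ℝ (Fin n) | x ≠ 0 ∧ ‖x‖ ^ 2 < 1 / a} :=
    isOpen_ne.inter (isOpen_lt hcont continuous_const)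
  have hKeq : ∀ x, x ≠ 0 → ‖x‖ ^ 2 < 1 / a →
      radialExt K (quadric (-1) x) = radialExt K (quadric a x) := by
    intro x hx hxa
    have h1 : (fun y => confExt v (quadric (-1) y)) =ᶠ[𝓝 x] fun y => confExt v (quadric a y) := by
      filter_upwards [hopen.mem_nhds ⟨hx, hxa⟩] with y hy using hcon y hy.1 hy.2
    have h2 := (InnerProductSpace.laplacian_congr_nhds h1).self_of_nhds
    rw [laplacian_confExt_quadric hn hv hsol (by norm_num) (Or.inl hx),
      laplacian_confExt_quadric hn hv hsol ha.ne' (Or.inl hx), hcon x hx hxa] at h2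
    have h3 : 0 < confExt v (quadric a x) ^ (((n : ℝ) + 2) / ((n : ℝ) - 2)) :=
      Real.rpow_pos_of_pos (confExt_pos hsol (quadric_regular (Or.inl hx))) _
    have h4 := mul_right_cancel₀ h3.ne' (neg_injective h2)
    linarith
  obtain ⟨y, t, hy, hne⟩ := exists_fderiv_radialExt_vertical_ne hK hK_ne
  have hmono := monotone_radialExt hK hK_nonneg hy
  have hy' : 0 < ‖y‖ := norm_pos_iff.2 hy
  have hconst : ∀ t₁ t₂, t₁ ≤ t₂ → radialExt K (pt y t₁) = radialExt K (pt y t₂) := by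
    intro t₁ t₂ ht
    -- At `x = (c/2) y` the heights tend to `1` and `-1/a` as `c → 0`; dividing by `c` sends them to
    -- `±∞`, past any given `t₁`, `t₂`.
    have hev : ∀ᶠ c in 𝓝[>] (0 : ℝ), (c / 2 * ‖y‖) ^ 2 < 1 / a ∧
        c * t₂ < 1 - (c / 2 * ‖y‖) ^ 2 ∧ a * (c / 2 * ‖y‖) ^ 2 - 1 / a < c * t₁ := by
      have ha' : 0 < 1 / a := by positivity
      refine nhdsWithin_le_nhds ?_
      refine (ContinuousAt.eventually_lt (by fun_prop) (by fun_prop) (by simpa using ha)).and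
        ((ContinuousAt.eventually_lt (by fun_prop) (by fun_prop) (by simp)).and
        (ContinuousAt.eventually_lt (by fun_prop) (by fun_prop) (by simpa using ha)))
    obtain ⟨c, ⟨h1, h2, h3⟩, hc⟩ := (hev.and self_mem_nhdsWithin).exists
    have hc : 0 < c := hc
    have hx0 : (c / 2) • y ≠ 0 := smul_ne_zero (by positivity) hy
    have hxn : ‖(c / 2) • y‖ = c / 2 * ‖y‖ := by
      rw [norm_smul, Real.norm_of_nonneg (by positivity)]
    have h4 := hKeq ((c / 2) • y) hx0 (by rwa [hxn])
    have h5 : ∀ b : ℝ, quadric b ((c / 2) • y) =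
        c • pt y ((b * (c / 2 * ‖y‖) ^ 2 - 1 / b) / c) := by
      intro b
      rw [quadric, smul_pt, hxn, smul_smul, mul_div_cancel₀ _ hc.ne',
        mul_div_cancel₀ _ (two_ne_zero)]
    rw [h5, h5, radialExt_smul K hc, radialExt_smul K hc] at h4
    have h6 : t₂ ≤ (-1 * (c / 2 * ‖y‖) ^ 2 - 1 / -1) / c := by
      rw [le_div_iff₀ hc]; linarith
    have h7 : (a * (c / 2 * ‖y‖) ^ 2 - 1 / a) / c ≤ t₁ := by
      rw [div_le_iff₀ hc]; linarith
    have h8 := hmono h6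
    have h9 := hmono h7
    have h10 := hmono ht
    simp only at h8 h9 h10
    linarith
  have hfun : (fun s => radialExt K (pt y s)) = fun _ => radialExt K (pt y t) := by
    ext s
    rcases le_total s t with h | h
    · exact hconst _ _ h
    · exact (hconst _ _ h).symm
  have hder := hasDerivAt_comp_pt (differentiableAt_radialExt hK
    (pt_ne_zero (Or.inl hy : y ≠ 0 ∨ t < 0)))
  rw [hfun] at hder
  exact hne (hder.unique (hasDerivAt_const _ _))

theorem sphereComparison (hn : 3 ≤ n) {K v : Sph n → ℝ} (hK : ContMDiff (𝓡 n) 𝓘(ℝ, ℝ) 1 K)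
    (hK_nonneg : ∀ θ : Sph n, θ ≠ north n → θ ≠ south n → 0 ≤ dirDeriv K θ (dHeight θ))
    (hK_ne : ∃ θ : Sph n, θ ≠ north n ∧ θ ≠ south n ∧ dirDeriv K θ (dHeight θ) ≠ 0)
    (hv : ContMDiffOn (𝓡 n) 𝓘(ℝ, ℝ) 2 v {north n}ᶜ) (hsol : IsPosSolution K v) :
    ∃ B, SphereComparison (fun x => confExt v (quadric (-1) x)) (fun a x => confExt v (quadric a x))
      (fun x => 4 * radialExt K (quadric (-1) x)) (fun a x => 4 * radialExt K (quadric a x))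
      (((n : ℝ) + 2) / ((n : ℝ) - 2)) B := by
  obtain ⟨B, hB⟩ := exists_abs_radialExt_le hK
  have hn' : (3 : ℝ) ≤ n := by exact_mod_cast hn
  have hC : ∀ {a : ℝ} {x : EuclideanSpace ℝ (Fin n)}, (x ≠ 0 ∨ 0 < a) →
      ContDiffAt ℝ 2 (fun y => confExt v (quadric a y)) x := fun h =>
    ContDiffAt.comp _ (contDiffAt_confExt hv (quadric_regular h)) (contDiff_quadric _).contDiffAt
  refine ⟨4 * B, ?_, fun x hx => hC (Or.inl hx), fun x hx => ?_, fun x hx => ?_,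
    fun a ha x => hC (Or.inr ha), fun a ha x => ?_, fun a ha x => ?_, fun a ha x => ?_,
    fun a ha x hx hxa => ?_, fun a ha x => ?_, fun a ha x hx => ?_, fun a ha => ?_⟩
  · rw [le_div_iff₀ (by linarith)]; linarith
  · exact confExt_pos hsol (quadric_regular (Or.inl hx))
  · exact laplacian_confExt_quadric hn hv hsol (by norm_num) (Or.inl hx)
  · exact confExt_pos hsol (quadric_regular (Or.inr ha))
  · exact laplacian_confExt_quadric hn hv hsol ha.ne' (Or.inr ha)
  · have h1 : ContinuousAt (confExt v) (quadric a x) :=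
      (contDiffAt_confExt hv (quadric_regular (Or.inr ha))).continuousAt
    have h2 : ContinuousAt (fun q : ℝ × EuclideanSpace ℝ (Fin n) => quadric q.1 q.2) (a, x) := by
      have h3 : ContinuousAt (fun q : ℝ × EuclideanSpace ℝ (Fin n) =>
          ((2 : ℝ) • q.2, q.1 * ‖q.2‖ ^ 2 - 1 / q.1)) (a, x) := by
        refine ContinuousAt.prodMk (by fun_prop) (ContinuousAt.sub (by fun_prop) ?_)
        exact continuousAt_const.div continuousAt_fst ha.ne'
      exact continuous_pt.continuousAt.comp h3
    exact ContinuousAt.comp (f := fun q : ℝ × EuclideanSpace ℝ (Fin n) => quadric q.1 q.2) h1 h2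
  · have := monotone_radialExt hK hK_nonneg (smul_ne_zero two_ne_zero hx : (2 : ℝ) • x ≠ 0)
      (vertical_le ha hxa)
    simp only [quadric]
    simp only at this
    linarith
  · rw [abs_mul, abs_of_pos (by norm_num : (0 : ℝ) < 4)]
    have := hB _ (pt_ne_zero (quadric_regular (Or.inr ha : x ≠ 0 ∨ 0 < a)))
    simp only [quadric]
    linarith
  · simp only [quadric, hx]
    congr 2
    field_simp
    ring
  · exact exists_confExt_quadric_ne hn hK hK_nonneg hK_ne hv hsol ha

end Sph

/-! ### Starting the spheres and the lower bound at the pole -/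

namespace Sph

variable {n : ℕ}

/-- At the south pole the vertical direction is minus the radial one, so Euler's identity gives the
derivative `(n-2)/2 · V > 0`. Continuity and homogeneity extend the sign to a cone. -/
theorem exists_fderiv_confExt_pos_near_south (hn : 3 ≤ n) {K v : Sph n → ℝ}
    (hv : ContMDiffOn (𝓡 n) 𝓘(ℝ, ℝ) 2 v {north n}ᶜ) (hsol : IsPosSolution K v) :
    ∃ η > 0, ∀ (y : EuclideanSpace ℝ (Fin n)) (t : ℝ), t < 0 → ‖y‖ < η * -t →
      0 < fderiv ℝ (confExt v) (pt y t) (pt 0 1) := by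
  have hn' : (3 : ℝ) ≤ n := by exact_mod_cast hn
  have hreg : (0 : EuclideanSpace ℝ (Fin n)) ≠ 0 ∨ (-1 : ℝ) < 0 := Or.inr (by norm_num)
  have hC := contDiffAt_confExt hv hreg
  have hS : 0 < fderiv ℝ (confExt v) (pt 0 (-1)) (pt 0 1) := by
    have h1 := fderiv_apply_self_of_homogeneous (confExt_smul v) (hC.differentiableAt (by simp))
    have h2 : (pt 0 (-1) : EuclideanSpace ℝ (Fin (n + 1))) = (-1 : ℝ) • pt 0 1 := by
      rw [smul_pt]; simp
    have h3 := confExt_pos hsol hreg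
    nth_rewrite 2 [h2] at h1
    rw [map_smul, smul_eq_mul, smul_eq_mul] at h1
    have h4 : 0 < ((n : ℝ) - 2) / 2 * confExt v (pt 0 (-1)) := mul_pos (by linarith) h3
    linarith
  have hcont : ContinuousAt (fun y => fderiv ℝ (confExt v) (pt y (-1)) (pt 0 1))
      (0 : EuclideanSpace ℝ (Fin n)) := by
    have h1 : ContDiffAt ℝ 1 (fderiv ℝ (confExt v)) (pt (0 : EuclideanSpace ℝ (Fin n)) (-1)) :=
      hC.fderiv_right (by norm_num)
    have h2 : ContinuousAt (fun y : EuclideanSpace ℝ (Fin n) => pt y (-1)) 0 :=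
      (contDiff_pt (m := 0) contDiff_id contDiff_const).continuous.continuousAt
    have h3 : ContinuousAt (fun y => fderiv ℝ (confExt v) (pt y (-1)))
        (0 : EuclideanSpace ℝ (Fin n)) :=
      ContinuousAt.comp (f := fun y : EuclideanSpace ℝ (Fin n) => pt y (-1)) h1.continuousAt h2
    exact h3.clm_apply continuousAt_const
  obtain ⟨η, hη, hball⟩ := Metric.nhds_basis_ball.eventually_iff.1
    (hcont.eventually (lt_mem_nhds hS))
  refine ⟨η, hη, fun y t ht hy => ?_⟩
  have ht' : 0 < -t := by linarith
  have h1 : pt y t = (-t) • pt ((-t)⁻¹ • y) (-1) := by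
    rw [smul_pt, smul_smul, mul_inv_cancel₀ ht'.ne', one_smul]; simp
  rw [h1, fderiv_smul_of_homogeneous (confExt_smul v) ht']
  refine mul_pos (Real.rpow_pos_of_pos ht' _) (hball ?_)
  rw [mem_ball_zero_iff, norm_smul, norm_inv, Real.norm_of_nonneg ht'.le, inv_mul_lt_iff₀ ht']
  linarith

theorem confExt_quadric_le_start (hn : 3 ≤ n) {K v : Sph n → ℝ}
    (hv : ContMDiffOn (𝓡 n) 𝓘(ℝ, ℝ) 2 v {north n}ᶜ) (hsol : IsPosSolution K v)
    (hlow : ∃ c > 0, ∃ ρ > 0, ∀ x, 0 < ‖x‖ → ‖x‖ < ρ → c ≤ confExt v (quadric (-1) x)) :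
    ∃ a₀, 0 < a₀ ∧ a₀ ≤ 1 ∧ ∀ x, x ≠ 0 → ‖x‖ ^ 2 ≤ 1 / a₀ →
      confExt v (quadric a₀ x) ≤ confExt v (quadric (-1) x) := by
  have hn' : (3 : ℝ) ≤ n := by exact_mod_cast hn
  obtain ⟨η, hη, hder⟩ := exists_fderiv_confExt_pos_near_south hn hv hsol
  obtain ⟨c, hc, ρ, hρ, hcρ⟩ := hlow
  -- For `‖x‖ > R` one has `2‖x‖ < η(‖x‖² - 1)`, so `quadric (-1) x` and everything vertically below
  -- it lie in the cone of `hder`.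
  set R : ℝ := 2 / η + 1 with hR
  obtain ⟨c₀, hc₀, hzc₀⟩ : ∃ c₀ > 0, ∀ x, x ≠ 0 → ‖x‖ ≤ R → c₀ ≤ confExt v (quadric (-1) x) := by
    have hK : IsCompact {x : EuclideanSpace ℝ (Fin n) | ρ ≤ ‖x‖ ∧ ‖x‖ ≤ R} := by
      refine (isCompact_closedBall (0 : EuclideanSpace ℝ (Fin n)) R).of_isClosed_subset ?_ ?_
      · exact (isClosed_le continuous_const continuous_norm).inter
          (isClosed_le continuous_norm continuous_const)
      · intro x hx; simpa using hx.2
    have hne : ∀ x : EuclideanSpace ℝ (Fin n), ρ ≤ ‖x‖ → x ≠ 0 := fun x hx =>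
      norm_pos_iff.1 (hρ.trans_le hx)
    obtain ⟨c₁, hc₁, hmin⟩ := hK.exists_forall_le' (f := fun x => confExt v (quadric (-1) x)) (a := 0)
      (fun x hx => (ContinuousAt.comp (f := quadric (-1))
        (contDiffAt_confExt hv (quadric_regular (Or.inl (hne x hx.1)))).continuousAt
        (contDiff_quadric (m := 0) _).continuous.continuousAt).continuousWithinAt)
      (fun x hx => confExt_pos hsol (quadric_regular (Or.inl (hne x hx.1))))
    refine ⟨min c c₁, lt_min hc hc₁, fun x hx hxR => ?_⟩
    rcases lt_or_ge ‖x‖ ρ with h | h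
    · exact (min_le_left _ _).trans (hcρ x (norm_pos_iff.2 hx) h)
    · exact (min_le_right _ _).trans (hmin x ⟨h, hxR⟩)
  obtain ⟨M, hM⟩ := (isCompact_closedBall (0 : EuclideanSpace ℝ (Fin n)) R).bddAbove_image
    (f := fun x => confExt v (quadric 1 x))
    (fun x _ => (ContinuousAt.comp (f := quadric 1)
        (contDiffAt_confExt hv (quadric_regular (Or.inr one_pos))).continuousAt
        (contDiff_quadric (m := 0) _).continuous.continuousAt).continuousWithinAt)
  have hMx : ∀ x : EuclideanSpace ℝ (Fin n), ‖x‖ ≤ R → confExt v (quadric 1 x) ≤ M := fun x hx =>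
    hM (mem_image_of_mem _ (by simpa using hx))
  set s : ℝ := ((n : ℝ) - 2) / 2 with hs
  have hs0 : 0 < s := by rw [hs]; linarith
  obtain ⟨a₀, ha₀, ha₀1, ha₀M⟩ : ∃ a₀ > 0, a₀ ≤ 1 ∧ a₀ ^ s * M ≤ c₀ := by
    have h1 : ContinuousAt (fun a : ℝ => a ^ s * M) 0 :=
      (Real.continuousAt_rpow_const 0 s (Or.inr hs0.le)).mul continuousAt_const
    have h2 : ∀ᶠ a in 𝓝[>] (0 : ℝ), a ^ s * M < c₀ :=
      nhdsWithin_le_nhds (h1.eventually (gt_mem_nhds (by simpa [Real.zero_rpow hs0.ne'] using hc₀)))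
    have h3 : ∀ᶠ a in 𝓝[>] (0 : ℝ), a ∈ Ioc (0 : ℝ) 1 := Ioc_mem_nhdsGT one_pos
    obtain ⟨a, ha, ha'⟩ := (h2.and h3).exists
    exact ⟨a, ha'.1, ha'.2, ha.le⟩
  refine ⟨a₀, ha₀, ha₀1, fun x hx hxa => ?_⟩
  have hx' : 0 < ‖x‖ := norm_pos_iff.2 hx
  rcases le_or_gt ‖x‖ R with hxR | hxR
  -- Scaling gives `U_{a₀}(x) = a₀^s U₁(a₀ x)`; as `a₀ ≤ 1`, the point `a₀ x` stays in the ball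
  -- where `U₁ ≤ M`.
  · have h1 : quadric 1 (a₀ • x) = a₀ • quadric a₀ x := by
      rw [quadric, quadric, smul_pt, smul_comm, norm_smul, Real.norm_of_nonneg ha₀.le]
      congr 1
      field_simp
    have h2 := hMx (a₀ • x) (by
      rw [norm_smul, Real.norm_of_nonneg ha₀.le]; nlinarith)
    rw [h1, confExt_smul v a₀ ha₀, smul_eq_mul, Real.rpow_neg ha₀.le,
      inv_mul_le_iff₀ (Real.rpow_pos_of_pos ha₀ _)] at h2
    exact h2.trans (ha₀M.trans (hzc₀ x hx hxR))
  · have h2x : (2 : ℝ) • x ≠ 0 := smul_ne_zero two_ne_zero hx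
    have hnorm : ‖(2 : ℝ) • x‖ = 2 * ‖x‖ := by rw [norm_smul]; simp
    have hstep : 2 * ‖x‖ < η * -(-1 * ‖x‖ ^ 2 - 1 / -1) := by
      have h1 : 2 + η < η * ‖x‖ := by
        have : η * R = 2 + η := by rw [hR]; field_simp
        nlinarith
      have h2 : 1 ≤ ‖x‖ := by
        have : 0 < 2 / η := by positivity
        linarith
      nlinarith
    have hlt : ∀ t ≤ -1 * ‖x‖ ^ 2 - 1 / -1, t < 0 ∧ ‖(2 : ℝ) • x‖ < η * -t := by
      intro t ht
      have h1 : η * -(-1 * ‖x‖ ^ 2 - 1 / -1) ≤ η * -t := by gcongr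
      refine ⟨?_, by linarith⟩
      by_contra! h
      nlinarith
    have hmono : MonotoneOn (fun t => confExt v (pt ((2 : ℝ) • x) t))
        (Iic (-1 * ‖x‖ ^ 2 - 1 / -1)) := by
      have hd : ∀ t, HasDerivAt (fun t => confExt v (pt ((2 : ℝ) • x) t))
          (fderiv ℝ (confExt v) (pt ((2 : ℝ) • x) t) (pt 0 1)) t := fun t =>
        hasDerivAt_comp_pt ((contDiffAt_confExt hv (Or.inl h2x)).differentiableAt (by simp))
      refine monotoneOn_of_deriv_nonneg (convex_Iic _)
        (fun t _ => (hd t).continuousAt.continuousWithinAt)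
        (fun t _ => (hd t).differentiableAt.differentiableWithinAt) fun t ht => ?_
      rw [(hd t).deriv]
      have := hlt t (show t ∈ Iic _ from interior_subset ht)
      exact (hder _ t this.1 this.2).le
    have hle := vertical_le ha₀ hxa
    exact hmono (mem_Iic.2 hle) (mem_Iic.2 le_rfl) hle

theorem confExt_quadric_le (hn : 3 ≤ n) {K v : Sph n → ℝ} (hK : ContMDiff (𝓡 n) 𝓘(ℝ, ℝ) 1 K)
    (hK_nonneg : ∀ θ : Sph n, θ ≠ north n → θ ≠ south n → 0 ≤ dirDeriv K θ (dHeight θ))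
    (hK_ne : ∃ θ : Sph n, θ ≠ north n ∧ θ ≠ south n ∧ dirDeriv K θ (dHeight θ) ≠ 0)
    (hv : ContMDiffOn (𝓡 n) 𝓘(ℝ, ℝ) 2 v {north n}ᶜ) (hsol : IsPosSolution K v)
    (hlow : ∃ c > 0, ∃ ρ > 0, ∀ x, 0 < ‖x‖ → ‖x‖ < ρ → c ≤ confExt v (quadric (-1) x))
    {a : ℝ} (ha : 1 ≤ a) {x : EuclideanSpace ℝ (Fin n)} (hx : x ≠ 0) (hxa : ‖x‖ ^ 2 ≤ 1 / a) :
    confExt v (quadric a x) ≤ confExt v (quadric (-1) x) := by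
  obtain ⟨B, hB⟩ := sphereComparison hn hK hK_nonneg hK_ne hv hsol
  obtain ⟨a₀, ha₀, ha₀1, hstart⟩ := confExt_quadric_le_start hn hv hsol hlow
  exact hB.le_of_le_start (by simp; omega) ha₀ hstart (ha₀1.trans ha) x hx hxa

theorem confExt_equator_le (hn : 3 ≤ n) {K v : Sph n → ℝ} (hK : ContMDiff (𝓡 n) 𝓘(ℝ, ℝ) 1 K)
    (hK_nonneg : ∀ θ : Sph n, θ ≠ north n → θ ≠ south n → 0 ≤ dirDeriv K θ (dHeight θ))
    (hK_ne : ∃ θ : Sph n, θ ≠ north n ∧ θ ≠ south n ∧ dirDeriv K θ (dHeight θ) ≠ 0)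
    (hv : ContMDiffOn (𝓡 n) 𝓘(ℝ, ℝ) 2 v {north n}ᶜ) (hsol : IsPosSolution K v)
    (hlow : ∃ c > 0, ∃ ρ > 0, ∀ x, 0 < ‖x‖ → ‖x‖ < ρ → c ≤ confExt v (quadric (-1) x))
    {y : EuclideanSpace ℝ (Fin n)} {h : ℝ} (hy : y ≠ 0) (hh : 0 ≤ h) (hyh : ‖y‖ ^ 2 + h ^ 2 = 1) :
    confExt v (pt y 0) ≤ confExt v (pt y h) := by
  have hy' : 0 < ‖y‖ := norm_pos_iff.2 hy
  have h1h : 0 < 1 + h := by linarith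
  set x := (1 + h)⁻¹ • y with hx
  have hx0 : x ≠ 0 := smul_ne_zero (by positivity) hy
  have hxn : ‖x‖ = ‖y‖ / (1 + h) := by
    rw [hx, norm_smul, norm_inv, Real.norm_of_nonneg h1h.le, div_eq_inv_mul]
  have hy1 : ‖y‖ ≤ 1 := by nlinarith [sq_nonneg h]
  have hx1 : ‖x‖ ≤ 1 := by rw [hxn, div_le_one h1h]; linarith
  have hxpos : 0 < ‖x‖ := norm_pos_iff.2 hx0
  -- For `a = 1/‖x‖` the last coordinate `a‖x‖² - 1/a` is zero; here `x` is the stereographic image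
  -- of `(y, h)` from the south pole.
  have hle := confExt_quadric_le hn hK hK_nonneg hK_ne hv hsol hlow (a := 1 / ‖x‖)
    (by rw [le_div_iff₀ hxpos]; linarith) hx0 (by rw [one_div_one_div]; nlinarith)
  have hc : (0 : ℝ) < 2 / (1 + h) := by positivity
  have h2x : (2 : ℝ) • x = (2 / (1 + h)) • y := by rw [hx, smul_smul]; rfl
  have e1 : quadric (1 / ‖x‖) x = (2 / (1 + h)) • pt y 0 := by
    rw [quadric, h2x, smul_pt]
    congr 1
    field_simp
    ring
  have e2 : quadric (-1) x = (2 / (1 + h)) • pt y h := by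
    rw [quadric, h2x, smul_pt, hxn]
    congr 1
    field_simp
    linear_combination -hyh
  rw [e1, e2, confExt_smul v _ hc, confExt_smul v _ hc, smul_eq_mul, smul_eq_mul] at hle
  exact le_of_mul_le_mul_left hle (Real.rpow_pos_of_pos hc _)

/-- On the closed southern hemisphere compactness suffices, the distance being at least 1. On the
northern one, compare with the point vertically below at height zero and use `‖y‖ = sin d ≤ d`. -/
theorem exists_lower_bound_of_confExt_lower_bound (hn : 3 ≤ n) {K v : Sph n → ℝ}
    (hK : ContMDiff (𝓡 n) 𝓘(ℝ, ℝ) 1 K)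
    (hK_nonneg : ∀ θ : Sph n, θ ≠ north n → θ ≠ south n → 0 ≤ dirDeriv K θ (dHeight θ))
    (hK_ne : ∃ θ : Sph n, θ ≠ north n ∧ θ ≠ south n ∧ dirDeriv K θ (dHeight θ) ≠ 0)
    (hv : ContMDiffOn (𝓡 n) 𝓘(ℝ, ℝ) 2 v {north n}ᶜ) (hsol : IsPosSolution K v)
    (hlow : ∃ c > 0, ∃ ρ > 0, ∀ x, 0 < ‖x‖ → ‖x‖ < ρ → c ≤ confExt v (quadric (-1) x)) :
    ∃ C₀ : ℝ, 0 < C₀ ∧ ∀ θ : Sph n, θ ≠ north n →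
      C₀ * geoDist θ (north n) ^ (-(((n : ℝ) - 2) / 2)) ≤ v θ := by
  have hn' : (3 : ℝ) ≤ n := by exact_mod_cast hn
  have hs : -(((n : ℝ) - 2) / 2) ≤ 0 := by linarith
  obtain ⟨c₁, hc₁, hmin₁⟩ := (isCompact_sphere (0 : EuclideanSpace ℝ (Fin n)) 1).exists_forall_le'
    (f := fun y => confExt v (pt y 0)) (a := 0)
    (fun y hy => (ContinuousAt.comp (f := fun y : EuclideanSpace ℝ (Fin n) => pt y 0)
      (contDiffAt_confExt hv (Or.inl (ne_zero_of_mem_unit_sphere (⟨y, hy⟩ : Metric.sphere _ _)))).continuousAt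
      (contDiff_pt (m := 0) contDiff_id contDiff_const).continuous.continuousAt).continuousWithinAt)
    (fun y hy => confExt_pos hsol
      (Or.inl (ne_zero_of_mem_unit_sphere (⟨y, hy⟩ : Metric.sphere _ _))))
  have hheight : Continuous (height : Sph n → ℝ) := by
    unfold height; fun_prop
  have hnorth : height (north n) = 1 := by simp [height, north, lastVec]
  have hne : ∀ θ : Sph n, height θ ≤ 0 → θ ≠ north n := by
    rintro θ hθ rfl; linarith
  obtain ⟨c₂, hc₂, hmin₂⟩ := (isClosed_le hheight continuous_const).isCompact.exists_forall_le'
    (s := {θ : Sph n | height θ ≤ 0}) (f := v) (a := 0)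
    (hv.continuousOn.mono fun θ hθ => hne θ hθ) (fun θ hθ => (hsol θ (hne θ hθ)).1)
  refine ⟨min c₁ c₂, lt_min hc₁ hc₂, fun θ hθ => ?_⟩
  have hnθ : ‖(θ : EuclideanSpace ℝ (Fin (n + 1)))‖ = 1 := norm_eq_of_mem_sphere θ
  set d := geoDist θ (north n) with hd
  have hcos : Real.cos d = height θ := by
    rw [hd, geoDist, InnerProductGeometry.cos_angle, hnθ, norm_eq_of_mem_sphere]
    simp [north, lastVec, EuclideanSpace.inner_single_right, height]
  have hd0 : 0 ≤ d := InnerProductGeometry.angle_nonneg _ _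
  have hdpi : d ≤ Real.pi := InnerProductGeometry.angle_le_pi _ _
  rcases le_or_gt (height θ) 0 with hle | hgt
  · have hd1 : 1 ≤ d := by
      by_contra! h
      have : 0 < Real.cos d := Real.cos_pos_of_le_one (by rw [abs_of_nonneg hd0]; exact h.le)
      linarith
    have h1 : d ^ (-(((n : ℝ) - 2) / 2)) ≤ 1 := Real.rpow_le_one_of_one_le_of_nonpos hd1 hs
    have h2 := hmin₂ θ hle
    have h3 : min c₁ c₂ * d ^ (-(((n : ℝ) - 2) / 2)) ≤ c₂ * 1 := by
      gcongr
      exact min_le_right _ _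
    linarith
  · obtain ⟨y, h, hyh⟩ := exists_eq_pt (θ : EuclideanSpace ℝ (Fin (n + 1)))
    have hh : height θ = h := by rw [height, hyh, pt_last]
    have hsq : ‖y‖ ^ 2 + h ^ 2 = 1 := by rw [← norm_pt_sq, ← hyh, hnθ]; norm_num
    have hy : y ≠ 0 := by
      rintro rfl
      have : h = 1 := by
        rw [norm_zero] at hsq
        nlinarith
      exact hθ (Subtype.ext (by rw [hyh, this]; exact lastVec_eq_pt.symm))
    have hy' : 0 < ‖y‖ := norm_pos_iff.2 hy
    have hyd : ‖y‖ ≤ d := by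
      have h1 : Real.sin d ^ 2 = ‖y‖ ^ 2 := by
        rw [Real.sin_sq, hcos, hh]; linarith
      have h2 : 0 ≤ Real.sin d := Real.sin_nonneg_of_nonneg_of_le_pi hd0 hdpi
      have h3 : Real.sin d = ‖y‖ := (sq_eq_sq₀ h2 hy'.le).1 h1
      rw [← h3]; exact Real.sin_le hd0
    have h1 := confExt_equator_le hn hK hK_nonneg hK_ne hv hsol hlow hy (by linarith) hsq
    have h2 : pt y 0 = ‖y‖ • pt (‖y‖⁻¹ • y) 0 := by
      rw [smul_pt, smul_smul, mul_inv_cancel₀ hy'.ne', one_smul, mul_zero]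
    have h3 := hmin₁ (‖y‖⁻¹ • y) (by simp [norm_smul, hy])
    rw [← hyh, confExt, homExt_eq_of_norm_eq_one] at h1
    have h4 : confExt v (pt y 0) = ‖y‖ ^ (-(((n : ℝ) - 2) / 2)) * confExt v (pt (‖y‖⁻¹ • y) 0) := by
      rw [h2, confExt_smul v _ hy', smul_eq_mul]
    have h5 : d ^ (-(((n : ℝ) - 2) / 2)) ≤ ‖y‖ ^ (-(((n : ℝ) - 2) / 2)) :=
      Real.rpow_le_rpow_of_nonpos hy' hyd hs
    calc min c₁ c₂ * d ^ (-(((n : ℝ) - 2) / 2))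
        ≤ confExt v (pt (‖y‖⁻¹ • y) 0) * ‖y‖ ^ (-(((n : ℝ) - 2) / 2)) := by
          exact mul_le_mul ((min_le_left _ _).trans h3) h5 (Real.rpow_nonneg hd0 _) (hc₁.le.trans h3)
      _ = confExt v (pt y 0) := by rw [h4, mul_comm]
      _ ≤ v θ := h1

theorem confExt_lower_bound_of_liminf_pos {v : Sph n → ℝ}
    (hlim : 0 < liminf (fun θ : Sph n => ((v θ : ℝ) : EReal)) (𝓝[≠] (north n))) :
    ∃ c > 0, ∃ ρ > 0, ∀ x, 0 < ‖x‖ → ‖x‖ < ρ → c ≤ confExt v (quadric (-1) x) := by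
  obtain ⟨c, hc0, hc⟩ := EReal.lt_iff_exists_real_btwn.1 hlim
  have hc0 : 0 < c := by exact_mod_cast hc0
  have hev : ∀ᶠ θ in 𝓝[≠] (north n), c < v θ :=
    (eventually_lt_of_lt_liminf hc).mono fun θ hθ => by exact_mod_cast hθ
  have hq : Tendsto (fun x : EuclideanSpace ℝ (Fin n) => ‖quadric (-1) x‖ ^ (-(((n : ℝ) - 2) / 2)))
      (𝓝 0) (𝓝 1) := by
    have h0 : ‖quadric (-1) (0 : EuclideanSpace ℝ (Fin n))‖ = 1 := by
      have : ‖quadric (-1) (0 : EuclideanSpace ℝ (Fin n))‖ ^ 2 = 1 := by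
        rw [quadric, norm_pt_sq]; simp
      nlinarith [norm_nonneg (quadric (-1) (0 : EuclideanSpace ℝ (Fin n)))]
    have h1 : ContinuousAt (fun x : EuclideanSpace ℝ (Fin n) =>
        ‖quadric (-1) x‖ ^ (-(((n : ℝ) - 2) / 2))) 0 :=
      (contDiff_quadric (m := 0) _).continuous.norm.continuousAt.rpow_const
        (Or.inl (by rw [h0]; norm_num))
    have := h1.tendsto
    rwa [h0, Real.one_rpow] at this
  rw [eventually_nhdsWithin_iff] at hev
  obtain ⟨r, hr, hball⟩ := Metric.nhds_basis_ball.eventually_iff.1 hev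
  have hP : Tendsto (fun x : EuclideanSpace ℝ (Fin n) => ‖quadric (-1) x‖⁻¹ • quadric (-1) x)
      (𝓝 0) (𝓝 (lastVec n)) := by
    have h0 : quadric (-1) (0 : EuclideanSpace ℝ (Fin n)) = lastVec n := by
      rw [quadric, lastVec_eq_pt]; simp
    have hn0 : ‖lastVec n‖ = 1 := by simp [lastVec]
    have hcq := (contDiff_quadric (n := n) (m := 0) (-1)).continuous.continuousAt (x := 0)
    have hcP : ContinuousAt (fun x : EuclideanSpace ℝ (Fin n) =>
        ‖quadric (-1) x‖⁻¹ • quadric (-1) x) 0 :=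
      (hcq.norm.inv₀ (by rw [h0, hn0]; norm_num)).smul hcq
    have := hcP.tendsto
    rwa [h0, hn0, inv_one, one_smul] at this
  obtain ⟨ρ, hρ, hball'⟩ := Metric.nhds_basis_ball.eventually_iff.1
    ((hq.eventually (lt_mem_nhds (by norm_num : (1 / 2 : ℝ) < 1))).and
      (hP.eventually (Metric.ball_mem_nhds _ hr)))
  refine ⟨1 / 2 * c, by positivity, ρ, hρ, fun x hx hxρ => ?_⟩
  have hreg := quadric_regular (a := -1) (x := x) (Or.inl (norm_pos_iff.1 hx))
  obtain ⟨h1, h2⟩ := hball' (x := x) (by simpa using hxρ)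
  have hX : quadric (-1) x ≠ 0 := pt_ne_zero hreg
  have h3 : c < v (proj (quadric (-1) x) hX) :=
    hball (x := proj (quadric (-1) x) hX) (by simpa [Subtype.dist_eq, proj, north] using h2)
      (proj_pt_ne_north hreg)
  rw [confExt, homExt_eq _ v hX]
  gcongr

/-- Where `u < 1`, the exponent being at least 1 gives `u^p ≤ u`, so the equation yields `Δu ≤ C u`
and the puncture barrier applies. This covers a solution on the whole sphere, whose value at the
pole is not assumed positive. -/
theorem confExt_lower_bound (hn : 3 ≤ n) {K v : Sph n → ℝ} (hK : ContMDiff (𝓡 n) 𝓘(ℝ, ℝ) 1 K)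
    (hv : ContMDiffOn (𝓡 n) 𝓘(ℝ, ℝ) 2 v {north n}ᶜ) (hsol : IsPosSolution K v) :
    ∃ c > 0, ∃ ρ > 0, ∀ x, 0 < ‖x‖ → ‖x‖ < ρ → c ≤ confExt v (quadric (-1) x) := by
  have hn' : (3 : ℝ) ≤ n := by exact_mod_cast hn
  obtain ⟨B, hB⟩ := exists_abs_radialExt_le hK
  have hreg : ∀ {x : EuclideanSpace ℝ (Fin n)}, 0 < ‖x‖ →
      (2 : ℝ) • x ≠ 0 ∨ -1 * ‖x‖ ^ 2 - 1 / -1 < 0 := fun hx =>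
    quadric_regular (Or.inl (norm_pos_iff.1 hx))
  have hpos : ∀ x : EuclideanSpace ℝ (Fin n), 0 < ‖x‖ → 0 < confExt v (quadric (-1) x) :=
    fun x hx => confExt_pos hsol (hreg hx)
  refine exists_pos_lower_bound_near_puncture (by simp; omega) (C := 4 * max B 0) (ρ₀ := 1) (δ := 1)
    (by positivity) one_pos one_pos
    (fun x hx _ => ContDiffAt.comp x (contDiffAt_confExt hv (hreg hx))
      (contDiff_quadric _).contDiffAt) (fun x hx _ => hpos x hx) (fun x hx _ hx1 => ?_)
  rw [laplacian_confExt_quadric hn hv hsol (by norm_num) (Or.inl (norm_pos_iff.1 hx))]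
  set u := confExt v (quadric (-1) x) with hu
  have hu0 : 0 < u := hpos x hx
  have hp : u ^ (((n : ℝ) + 2) / ((n : ℝ) - 2)) ≤ u := by
    calc u ^ (((n : ℝ) + 2) / ((n : ℝ) - 2)) ≤ u ^ (1 : ℝ) :=
          Real.rpow_le_rpow_of_exponent_ge hu0 hx1.le (by rw [le_div_iff₀ (by linarith)]; linarith)
      _ = u := Real.rpow_one u
  have hp0 : 0 ≤ u ^ (((n : ℝ) + 2) / ((n : ℝ) - 2)) := Real.rpow_nonneg hu0.le _
  have hk : -radialExt K (quadric (-1) x) ≤ max B 0 :=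
    (neg_le_abs _).trans ((hB _ (pt_ne_zero (hreg hx))).trans (le_max_left _ _))
  calc -(4 * radialExt K (quadric (-1) x) * u ^ (((n : ℝ) + 2) / ((n : ℝ) - 2)))
      = 4 * (-radialExt K (quadric (-1) x) * u ^ (((n : ℝ) + 2) / ((n : ℝ) - 2))) := by ring
    _ ≤ 4 * (max B 0 * u) := by gcongr
    _ = 4 * max B 0 * u := by ring

theorem exists_geoDist_north_lt (hn : 3 ≤ n) {ε : ℝ} (hε : 0 < ε) :
    ∃ θ : Sph n, θ ≠ north n ∧ geoDist θ (north n) < ε := by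
  set y : EuclideanSpace ℝ (Fin n) := EuclideanSpace.single ⟨0, by omega⟩ 1 with hy
  have hy0 : y ≠ 0 := by simp [hy]
  have h1 : ContinuousAt (fun t : ℝ => InnerProductGeometry.angle (pt (t • y) 1) (lastVec n)) 0 := by
    have h2 : ContinuousAt (fun t : ℝ => (pt (t • y) 1, lastVec n)) 0 := by
      refine ContinuousAt.prodMk ?_ continuousAt_const
      have hty : ContDiff ℝ 0 fun t : ℝ => t • y := by fun_prop
      exact (contDiff_pt hty contDiff_const).continuous.continuousAt
    have h3 : ContinuousAt (fun q : EuclideanSpace ℝ (Fin (n + 1)) × EuclideanSpace ℝ (Fin (n + 1)) =>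
        InnerProductGeometry.angle q.1 q.2) (pt ((0 : ℝ) • y) 1, lastVec n) :=
      InnerProductGeometry.continuousAt_angle (by simp [← lastVec_eq_pt, lastVec])
        (by simp [lastVec])
    exact ContinuousAt.comp (f := fun t : ℝ => (pt (t • y) 1, lastVec n)) h3 h2
  have h2 : InnerProductGeometry.angle (pt ((0 : ℝ) • y) 1) (lastVec n) = 0 := by
    rw [zero_smul, ← lastVec_eq_pt]
    exact InnerProductGeometry.angle_self (by simp [lastVec])
  have h3 : ∀ᶠ t in 𝓝[>] (0 : ℝ),
      InnerProductGeometry.angle (pt (t • y) 1) (lastVec n) < ε :=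
    nhdsWithin_le_nhds (h1.eventually (gt_mem_nhds (by simp only [h2]; exact hε)))
  obtain ⟨t, ht, ht0⟩ := (h3.and self_mem_nhdsWithin).exists
  have hreg : t • y ≠ 0 ∨ (1 : ℝ) < 0 := Or.inl (smul_ne_zero (ne_of_gt ht0) hy0)
  refine ⟨proj _ (pt_ne_zero hreg), proj_pt_ne_north hreg, ?_⟩
  change InnerProductGeometry.angle (‖pt (t • y) 1‖⁻¹ • pt (t • y) 1) (lastVec n) < ε
  rwa [InnerProductGeometry.angle_smul_left_of_pos _ _
    (inv_pos.2 (norm_pos_iff.2 (pt_ne_zero hreg)))]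

end Sph

/-! ### The blow-up estimate and nonexistence on the whole sphere -/

theorem theorem1p8 (n : ℕ) (hn : 3 ≤ n) (K : Sph n → ℝ)
    (hK : ContMDiff (𝓡 n) 𝓘(ℝ, ℝ) 1 K)
    (hK_nonneg : ∀ θ : Sph n, θ ≠ Sph.north n → θ ≠ Sph.south n →
      0 ≤ Sph.dirDeriv K θ (Sph.dHeight θ))
    (hK_ne : ∃ θ : Sph n, θ ≠ Sph.north n ∧ θ ≠ Sph.south n ∧
      Sph.dirDeriv K θ (Sph.dHeight θ) ≠ 0) :
    (∀ v : Sph n → ℝ,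
      ContMDiffOn (𝓡 n) 𝓘(ℝ, ℝ) 2 v {Sph.north n}ᶜ →
      Sph.IsPosSolution K v →
      0 < liminf (fun θ : Sph n => ((v θ : ℝ) : EReal)) (𝓝[≠] (Sph.north n)) →
      ∃ C₀ : ℝ, 0 < C₀ ∧ ∀ θ : Sph n, θ ≠ Sph.north n →
        C₀ * Sph.geoDist θ (Sph.north n) ^ (-(((n : ℝ) - 2) / 2)) ≤ v θ) ∧
    ¬ ∃ v : Sph n → ℝ,
      ContMDiff (𝓡 n) 𝓘(ℝ, ℝ) 2 v ∧ Sph.IsPosSolution K v := by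
  constructor
  · intro v hv hsol hlim
    exact Sph.exists_lower_bound_of_confExt_lower_bound hn hK hK_nonneg hK_ne hv hsol
      (Sph.confExt_lower_bound_of_liminf_pos hlim)
  · rintro ⟨v, hv, hsol⟩
    obtain ⟨C₀, hC₀, hle⟩ := Sph.exists_lower_bound_of_confExt_lower_bound hn hK hK_nonneg hK_ne
      hv.contMDiffOn hsol (Sph.confExt_lower_bound hn hK hv.contMDiffOn hsol)
    have hn' : (3 : ℝ) ≤ n := by exact_mod_cast hn
    have hs : 0 < ((n : ℝ) - 2) / 2 := by linarith
    obtain ⟨M, hM⟩ := (isCompact_univ (X := Sph n)).bddAbove_image hv.continuous.continuousOn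
    have htop : Tendsto (fun d : ℝ => C₀ * d ^ (-(((n : ℝ) - 2) / 2))) (𝓝[>] 0) atTop :=
      (tendsto_rpow_neg_nhdsGT_zero (neg_neg_of_pos hs)).const_mul_atTop hC₀
    obtain ⟨ε, hε, hεM⟩ := mem_nhdsGT_iff_exists_Ioo_subset.1 (htop.eventually_gt_atTop M)
    obtain ⟨θ, hθ, hd⟩ := Sph.exists_geoDist_north_lt hn hε
    have hd0 : 0 < Sph.geoDist θ (Sph.north n) := by
      refine lt_of_le_of_ne (InnerProductGeometry.angle_nonneg _ _) fun h0 => hθ ?_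
      have h1 := (InnerProductGeometry.angle_eq_zero_iff.1 h0.symm).2
      obtain ⟨r, hr, hr'⟩ := h1
      have h2 : ‖(Sph.north n : EuclideanSpace ℝ (Fin (n + 1)))‖ = 1 := norm_eq_of_mem_sphere _
      rw [hr', norm_smul, norm_eq_of_mem_sphere, Real.norm_of_nonneg hr.le, mul_one] at h2
      refine Subtype.ext ?_
      rw [hr', h2, one_smul]
    have h1 : M < C₀ * Sph.geoDist θ (Sph.north n) ^ (-(((n : ℝ) - 2) / 2)) := hεM ⟨hd0, hd⟩
    have h2 : v θ ≤ M := hM (mem_image_of_mem v (mem_univ θ))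
    linarith [hle θ hθ]
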